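/- **Setting.** Let $(X,d,\mu)$ be a metric measure space: $\mu$ is a Borel measure on the metric space $(X,d)$ with $0<\mu(B(x,r))<\infty$ for all $x\in X$, $r>0$, where $B(x,r)$ is the open ball. For measurable $E\subseteq X$, $\mathcal P(E)$ is the set of measurable $q:E\to(0,\infty]$ with $\operatorname{ess\,inf}_E q>0$; $\mathcal P_b(X)$ is the set of essentially bounded elements of $\mathcal P(X)$; and $\mathcal P_b^{\log}(X)$ is the set of $p\in\mathcal P_b(X)$ such that $f=1/p$ is log-Hölder continuous, i.e. for some $C>0$, $|f(x)-f(y)|\le C/\log(e+1/d(x,y))$ for all $x,y\in X$. We write $f\ll g$ if $\operatorname{ess\,inf}(g-f)>0$, and $f_E^-=\operatorname{ess\,inf}_E f$, $f^+=\operatorname{ess\,sup}_X f$. Put $\|f\|_{L^{p(\cdot)}(E)}=\inf\{\lambda>0:\rho_{p}(f/\lambda)\le1\}$ with $\rho_p(f)=\int_E|f|^{p(x)}d\mu$. For $g=\{g_k\}_{k\in\mathbb Z}$ put $\rho_{q,p}(g)=\sum_{k}\inf\{\lambda>0:\rho_p(g_k\lambda^{-1/q(\cdot)})\le1\}$ (with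 $\lambda^{1/\infty}=1$) and $\|g\|_{\ell^{q(\cdot)}(L^{p(\cdot)}(E))}=\inf\{\lambda>0:\rho_{q,p}(g/\lambda)\le 1\}$ (with $\inf\emptyset=\infty$). The space $\ell^{q(\cdot)}(L^{p(\cdot)}(E))$ consists of all $g$ with measurable $g_k$, $\rho_p(g_k)<\infty$ for all $k$, and $\rho_{q,p}(g/\lambda)<\infty$ for some $\lambda>0$. For a measurable, a.e. finite $u:E\to[-\infty,\infty]$, $\mathbb D^{s(\cdot)}(u)$ is the set of sequences of measurable $g_k:E\to[0,\infty]$ for which there is a null set $N$ such that for all $k\in\mathbb Z$ and all $x,y\in E\setminus N$ with $2^{-k-1}\le d(x,y)<2^{-k}$, $$|u(x)-u(y)|\le d(x,y)^{s(x)}g_k(x)+d(x,y)^{s(y)}g_k(y).$$ The Hajłasz–Besov space $\dot N^{s(\cdot)}_{p(\cdot),q(\cdot)}(E)$ consists of those $u$ with $\inf_{g\in\mathbb D^{s(\cdot)}(u)}\|g\|_{\ell^{q(\cdot)}(L^{p(\cdot)}(E))}<\infty$. **Theorem.** Let $\delta\in(0,\infty)$, $b\in(0,1]$, $\sigma\in(1,\infty)$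 and $Q\in\mathcal P_b^{\log}(X)$ be such that $\mu(B(x,r))\ge b\,r^{Q(x)}$ for all $x\in X$, $r\in(0,\delta]$. Let $p,\varepsilon\in\mathcal P_b^{\log}(X)$ and $s\in\mathcal P_b(X)$ with $\varepsilon\ll s$. Below, $B_0=B(x_0,r_0)$ with $0<r_0\le\delta/\sigma$, $\sigma B_0=B(x_0,\sigma r_0)$, $q\in\mathcal P(\sigma B_0)$, $u\in\dot N^{s(\cdot)}_{p(\cdot),q(\cdot)}(\sigma B_0)$, $g\in\mathbb D^{s(\cdot)}(u)\cap\ell^{q(\cdot)}(L^{p(\cdot)}(\sigma B_0))$ are arbitrary, $\|g\|=\|g\|_{\ell^{q(\cdot)}(L^{p(\cdot)}(\sigma B_0))}$, and $u_{B_0}$ is the average of $u$ over $B_0$. The constants $C_S,C_{MT1},C_{MT2},C_H>0$ depend only on $b,\delta,\sigma,p,\varepsilon,s,Q$; more precisely, they depend only on $b,\delta,\sigma$ and a number $\Lambda>0$ such that $\Lambda^{-1}\le Q,p,\varepsilon,s\le\Lambda$ a.e., $s-\varepsilon\ge\Lambda^{-1}$ a.e., the log-Hölder inequality holds for $1/Q,1/p,1/\varepsilon$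 with $C=\Lambda$, and, in (i) respectively (iii), $Q-\varepsilon p\ge\Lambda^{-1}$ respectively $\varepsilon p-Q\ge\Lambda^{-1}$ a.e. (such a $\Lambda$ always exists). They depend neither on $B_0,q,u,g$ nor otherwise on $(X,d,\mu)$. (i) If $\varepsilon p\ll Q$ and $\gamma_\varepsilon=\frac{Qp}{Q-\varepsilon p}$, then $$\inf_{c\in\mathbb R}\|u-c\|_{L^{\gamma_\varepsilon(\cdot)}(B_0)}\le C_S\Big(\frac{\mu(B_0)}{r_0^{Q(x_0)}}\Big)^{1/(\gamma_\varepsilon)^-_{B_0}}\|g\|.$$ (ii) If $\varepsilon p=Q$ and $\|g\|>0$, then $u$ is integrable on $B_0$ and $$\frac1{\mu(B_0)}\int_{B_0}\exp\Big(C_{MT1}\frac{|u(x)-u_{B_0}|}{\|g\|}\Big)d\mu(x)\le C_{MT2}.$$ (iii) If $\varepsilon p\gg Q$ and $\alpha_\varepsilon=\varepsilon-\frac Qp$, then $u$ is integrable on $B_0$ and $$\|u-u_{B_0}\|_{L^\infty(B_0)}\le C_H\,r_0^{\alpha_\varepsilon(x_0)}\|g\|.$$ Moreover, $u$ has a continuous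 representative $\tilde u$ on $B_0$ such that, for all $x,y\in B_0$, $$|\tilde u(x)-\tilde u(y)|\le D_H(r_0)\,\|g\|\,d(x,y)^{\alpha_\varepsilon(x)},\qquad D_H(r_0)=2^{\alpha_\varepsilon^++1}C_H\Big(\frac{\sigma\delta}{(\sigma-1)r_0}\Big)^{\alpha_\varepsilon^+}.$$ -/

import Mathlib

open MeasureTheory
open scoped ENNReal

universe w

set_option linter.unusedSectionVars false

namespace HajlaszBesov

noncomputable section

/-! ### Metric measure spaces and exponents -/

section Exponents

variable {X : Type*} [MetricSpace X] [MeasurableSpace X]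

/-- All balls of positive radius have positive and finite measure. -/
def IsMetricMeasure (μ : Measure X) : Prop :=
  ∀ (x : X) (r : ℝ), 0 < r → 0 < μ (Metric.ball x r) ∧ μ (Metric.ball x r) < ∞

/-- `μ (B(x, r)) ≥ b r ^ Q(x)` for all `x` and all `r ∈ (0, δ]`. -/
def LowerRegular (μ : Measure X) (b δ : ℝ) (Q : X → ℝ) : Prop :=
  ∀ (x : X) (r : ℝ), 0 < r → r ≤ δ → ENNReal.ofReal (b * r ^ Q x) ≤ μ (Metric.ball x r)

/-- The class `𝒫(E)` of variable exponents `q : E → (0, ∞]` on a measurable set `E`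
(only the values on `E` matter). -/
structure IsExponentOn (μ : Measure X) (E : Set X) (q : X → ℝ≥0∞) : Prop where
  measurable : Measurable (fun x : E => q x)
  pos : ∀ x ∈ E, 0 < q x
  essInf_pos : 0 < essInf q (μ.restrict E)

/-- `m ≤ f ≤ M` almost everywhere. -/
def EssBetween (μ : Measure X) (m M : ℝ) (f : X → ℝ) : Prop :=
  ∀ᵐ x ∂μ, m ≤ f x ∧ f x ≤ M

/-- The class `𝒫_b(X)` of (essentially) bounded variable exponents. -/
structure IsBddExponent (μ : Measure X) (p : X → ℝ) : Prop where
  measurable : Measurable p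
  pos : ∀ x, 0 < p x
  bounds : ∃ m M : ℝ, 0 < m ∧ EssBetween μ m M p

/-- The log-Hölder inequality with constant `C`. -/
def LogHolderWith (C : ℝ) (f : X → ℝ) : Prop :=
  ∀ x y : X, |f x - f y| ≤ C / Real.log (Real.exp 1 + 1 / dist x y)

/-- The class `𝒫_b^log(X)`: bounded exponents `p` with `1 / p` log-Hölder continuous. -/
structure IsLogExponent (μ : Measure X) (p : X → ℝ) : Prop extends IsBddExponent μ p where
  logHolder : ∃ C : ℝ, 0 < C ∧ LogHolderWith C (fun x => 1 / p x)

/-- `g - f ≥ κ` almost everywhere. -/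
def EssGap (μ : Measure X) (κ : ℝ) (f g : X → ℝ) : Prop :=
  ∀ᵐ x ∂μ, κ ≤ g x - f x

/-- The relation `f ≪ g`: the essential infimum of `g - f` is positive. -/
def EssLT (μ : Measure X) (f g : X → ℝ) : Prop :=
  ∃ κ : ℝ, 0 < κ ∧ EssGap μ κ f g

/-- The number `Λ` controls the essential bounds of `Q, p, ε, s`, the log-Hölder constants of
`1/Q, 1/p, 1/ε` and the gap between `ε` and `s`.  -/
structure ControlledBy (Λ : ℝ) (μ : Measure X) (Q p ε s : X → ℝ) : Prop where
  bounds_Q : EssBetween μ Λ⁻¹ Λ Q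
  bounds_p : EssBetween μ Λ⁻¹ Λ p
  bounds_ε : EssBetween μ Λ⁻¹ Λ ε
  bounds_s : EssBetween μ Λ⁻¹ Λ s
  log_Q : LogHolderWith Λ (fun x => 1 / Q x)
  log_p : LogHolderWith Λ (fun x => 1 / p x)
  log_ε : LogHolderWith Λ (fun x => 1 / ε x)
  gap : EssGap μ Λ⁻¹ ε s

theorem log_pos_aux (t : ℝ) (ht : 0 ≤ t) : 0 < Real.log (Real.exp 1 + 1 / t) := by
  apply Real.log_pos
  have h1 : (1 : ℝ) < Real.exp 1 := by simp
  have h2 : 0 ≤ 1 / t := by positivity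
  linarith

theorem LogHolderWith.mono {C D : ℝ} (h : C ≤ D) {f : X → ℝ} (hf : LogHolderWith C f) :
    LogHolderWith D f := fun x y =>
  (hf x y).trans (div_le_div_of_nonneg_right h (log_pos_aux _ dist_nonneg).le)

theorem IsBddExponent.exists_bound {μ : Measure X} {p : X → ℝ} (hp : IsBddExponent μ p) :
    ∃ L : ℝ, 0 < L ∧ ∀ Λ, L ≤ Λ → EssBetween μ Λ⁻¹ Λ p := by
  obtain ⟨m, M, hm, h⟩ := hp.bounds
  refine ⟨max m⁻¹ M, lt_max_of_lt_left (inv_pos.2 hm), fun Λ hΛ => ?_⟩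
  filter_upwards [h] with x hx
  exact ⟨(inv_le_of_inv_le₀ hm ((le_max_left _ _).trans hΛ)).trans hx.1,
    hx.2.trans ((le_max_right _ _).trans hΛ)⟩

/-- Every admissible quadruple of exponents is controlled by all sufficiently large `Λ`. -/
theorem exists_controlledBy {μ : Measure X} {Q p ε s : X → ℝ} (hQ : IsLogExponent μ Q)
    (hp : IsLogExponent μ p) (hε : IsLogExponent μ ε) (hs : IsBddExponent μ s)
    (hεs : EssLT μ ε s) : ∃ L : ℝ, 0 < L ∧ ∀ Λ, L ≤ Λ → ControlledBy Λ μ Q p ε s := by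
  obtain ⟨a₁, ha₁, h₁⟩ := hQ.toIsBddExponent.exists_bound
  obtain ⟨a₂, _, h₂⟩ := hp.toIsBddExponent.exists_bound
  obtain ⟨a₃, _, h₃⟩ := hε.toIsBddExponent.exists_bound
  obtain ⟨a₄, _, h₄⟩ := hs.exists_bound
  obtain ⟨c₁, _, k₁⟩ := hQ.logHolder
  obtain ⟨c₂, _, k₂⟩ := hp.logHolder
  obtain ⟨c₃, _, k₃⟩ := hε.logHolder
  obtain ⟨κ, hκ, hg⟩ := hεs
  refine ⟨max a₁ (max a₂ (max a₃ (max a₄ (max c₁ (max c₂ (max c₃ κ⁻¹)))))),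
    lt_max_of_lt_left ha₁, fun Λ hΛ => ?_⟩
  simp only [max_le_iff] at hΛ
  obtain ⟨e₁, e₂, e₃, e₄, e₅, e₆, e₇, e₈⟩ := hΛ
  refine ⟨h₁ _ e₁, h₂ _ e₂, h₃ _ e₃, h₄ _ e₄, k₁.mono e₅, k₂.mono e₆, k₃.mono e₇, ?_⟩
  filter_upwards [hg] with x hx
  exact (inv_le_of_inv_le₀ hκ e₈).trans hx

/-- The standing hypotheses on the metric measure space and on the exponents, in the quantitative
form with control parameter `Λ`. -/
structure Setting (b δ Λ : ℝ) (μ : Measure X) (Q p ε s : X → ℝ) : Prop where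
  metricMeasure : IsMetricMeasure μ
  lowerRegular : LowerRegular μ b δ Q
  Q_mem : IsLogExponent μ Q
  p_mem : IsLogExponent μ p
  ε_mem : IsLogExponent μ ε
  s_mem : IsBddExponent μ s
  ε_lt_s : EssLT μ ε s
  controlled : ControlledBy Λ μ Q p ε s

end Exponents

/-! ### Function spaces on a measurable set `E`

Functions on `E` are represented by functions on `X` of which only the values on `E` matter. Since
only absolute values enter the modulars, these are defined for functions with values in
`[0, ∞]`. -/

section Spaces

variable {X : Type*} [MetricSpace X] [MeasurableSpace X]

/-- The semi-modular `∫_E |f|^{p(x)} dμ` of `L^{p(·)}(E)`. -/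
def modular (μ : Measure X) (E : Set X) (p : X → ℝ) (f : X → ℝ≥0∞) : ℝ≥0∞ :=
  ∫⁻ x in E, f x ^ p x ∂μ

/-- The Luxemburg quasi-norm of `L^{p(·)}(E)` (infinite if there is no admissible `l`). -/
def luxNorm (μ : Measure X) (E : Set X) (p : X → ℝ) (f : X → ℝ≥0∞) : ℝ≥0∞ :=
  ⨅ (l : ℝ) (_ : 0 < l) (_ : modular μ E p (fun x => f x / ENNReal.ofReal l) ≤ 1),
    ENNReal.ofReal l

/-- The semi-modular of `ℓ^{q(·)}(L^{p(·)}(E))`; the convention `l ^ (1/∞) = 1` is built in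
because `∞⁻¹ = 0`. -/
def mixedModular (μ : Measure X) (E : Set X) (p : X → ℝ) (q : X → ℝ≥0∞) (g : ℤ → X → ℝ≥0∞) :
    ℝ≥0∞ :=
  ∑' k : ℤ, ⨅ (l : ℝ) (_ : 0 < l)
    (_ : modular μ E p (fun x => g k x / ENNReal.ofReal (l ^ ((q x)⁻¹).toReal)) ≤ 1),
    ENNReal.ofReal l

/-- The quasi-norm of `ℓ^{q(·)}(L^{p(·)}(E))`. -/
def mixedNorm (μ : Measure X) (E : Set X) (p : X → ℝ) (q : X → ℝ≥0∞) (g : ℤ → X → ℝ≥0∞) :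
    ℝ≥0∞ :=
  ⨅ (l : ℝ) (_ : 0 < l)
    (_ : mixedModular μ E p q (fun k x => g k x / ENNReal.ofReal l) ≤ 1), ENNReal.ofReal l

/-- Membership in `ℓ^{q(·)}(L^{p(·)}(E))`. -/
structure MemMixed (μ : Measure X) (E : Set X) (p : X → ℝ) (q : X → ℝ≥0∞)
    (g : ℤ → X → ℝ≥0∞) : Prop where
  measurable : ∀ k, Measurable (fun x : E => g k x)
  memLp : ∀ k, modular μ E p (g k) < ∞
  finite : ∃ l : ℝ, 0 < l ∧ mixedModular μ E p q (fun k x => g k x / ENNReal.ofReal l) < ∞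

/-- `g ∈ 𝔻^{s(·)}(u)`: the sequence `g` is a vector `s(·)`-gradient of `u` on `E`. -/
structure IsVectorGradient (μ : Measure X) (E : Set X) (s : X → ℝ) (u : X → EReal)
    (g : ℤ → X → ℝ≥0∞) : Prop where
  measurable : ∀ k, Measurable (fun x : E => g k x)
  ineq : ∃ N : Set X, μ N = 0 ∧ ∀ k : ℤ, ∀ x ∈ E \ N, ∀ y ∈ E \ N,
    (2 : ℝ) ^ (-k - 1) ≤ dist x y → dist x y < (2 : ℝ) ^ (-k) →
      (u x - u y).abs ≤
        ENNReal.ofReal (dist x y ^ s x) * g k x + ENNReal.ofReal (dist x y ^ s y) * g k y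

/-- The quasi-semi-norm of the homogeneous Hajłasz–Besov space on `E`. -/
def besovNorm (μ : Measure X) (E : Set X) (s p : X → ℝ) (q : X → ℝ≥0∞) (u : X → EReal) : ℝ≥0∞ :=
  ⨅ (g : ℤ → X → ℝ≥0∞) (_ : IsVectorGradient μ E s u g), mixedNorm μ E p q g

/-- Membership in the homogeneous Hajłasz–Besov space on `E`. -/
structure MemBesov (μ : Measure X) (E : Set X) (s p : X → ℝ) (q : X → ℝ≥0∞)
    (u : X → EReal) : Prop where
  measurable : Measurable (fun x : E => u x)
  ae_finite : ∀ᵐ x ∂μ.restrict E, u x ≠ ⊤ ∧ u x ≠ ⊥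
  norm_lt_top : besovNorm μ E s p q u < ∞

/-- The function `|u - c|`, with values in `[0, ∞]`. -/
def absSub (u : X → EReal) (c : ℝ) (x : X) : ℝ≥0∞ := (u x - (c : EReal)).abs

/-- The integral average of the (almost everywhere finite) function `u` over `E`. -/
def avg (μ : Measure X) (E : Set X) (u : X → EReal) : ℝ := ⨍ x in E, (u x).toReal ∂μ

/-- The Sobolev exponent `γ_ε = Qp / (Q - εp)`. -/
def sobolevExp (Q p ε : X → ℝ) (x : X) : ℝ := Q x * p x / (Q x - ε x * p x)

/-- The Hölder exponent `α_ε = ε - Q / p`. -/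
def holderExp (Q p ε : X → ℝ) (x : X) : ℝ := ε x - Q x / p x

/-- A ball `B(x₀, r₀)` with `0 < r₀ ≤ δ / σ`, an exponent `q ∈ 𝒫(σB₀)`, a function `u` in the
homogeneous Hajłasz–Besov space on `σB₀` and a vector gradient `g` of `u` in
`ℓ^{q(·)}(L^{p(·)}(σB₀))`. -/
structure LocalData (δ σ : ℝ) (μ : Measure X) (p s : X → ℝ) (x₀ : X) (r₀ : ℝ) (q : X → ℝ≥0∞)
    (u : X → EReal) (g : ℤ → X → ℝ≥0∞) : Prop where
  radius_pos : 0 < r₀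
  radius_le : r₀ ≤ δ / σ
  q_mem : IsExponentOn μ (Metric.ball x₀ (σ * r₀)) q
  u_mem : MemBesov μ (Metric.ball x₀ (σ * r₀)) s p q u
  g_grad : IsVectorGradient μ (Metric.ball x₀ (σ * r₀)) s u g
  g_mem : MemMixed μ (Metric.ball x₀ (σ * r₀)) p q g

end Spaces

end

end HajlaszBesov

namespace HajlaszBesov

/-! The scale index `k` and the exponent `q` are lost at the outset. If the quasi-norm of `g` is
below `lam`, each `g k`, divided by some `2 * l` with `l ≤ lam`, has modular at most one. For points
at distance `d ≈ 2 ^ (-k)` the gap `s - ε ≥ Λ⁻¹` gives `d ^ s ≤ C * ω ^ |k| * d ^ ε` with `ω < 1`.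
The weighted terms therefore sum to one function `H` whose `p`-modular is bounded by a constant, and
`2 * lam * H` is an ordinary Hajłasz gradient of `u` of order `ε` (`exists_gradient_majorant`).

By lower regularity, every ball `B(x, R)` of radius at most `δ` in `σB₀` contains a good point `z`
with `H z ^ p z ≲ R ^ (-Q x)`, because the mean of `H ^ p` over the ball is that small. Log-Hölder
continuity allows exponents to be evaluated at any point at distance comparable to `R`, at the cost
of a constant (`exists_rpow_comparison`); hence `H z ≲ R ^ (-(Q x / p x))`. Joining `x` to a fixed
good point through good points of the balls `B(x, R / 2 ^ j)` gives, with `α = ε - Q / p` and for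
every `n`, `|u x - c| ≲ lam * ((R / 2 ^ n) ^ ε x * H x + ∑ j ≤ n, (R / 2 ^ j) ^ α x)`. Individual
points replace ball averages, so neither doubling nor prior integrability of `u` is needed.

The three cases are the three signs of `α`. If `α < 0`, the last summand dominates, and stopping at
the radius `H ^ (-p / Q)` balances the two terms into `H ^ (p / γ)`, whose `γ`-th power is
integrable. If `α = 0`, the sum counts steps, and the same stopping radius gives a logarithm of `H`,
which is exponentially integrable. If `α > 0`, the sum is geometric and `n → ∞` removes `H x`;
chains at two points with `R ≈ d(x, y)` yield Hölder continuity. -/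

/-! ### Log-Hölder exponents and powers of radii -/

theorem rpow_le_exp_mul_rpow {R a c Θ : ℝ} (hR : 0 < R) (h : |a - c| * |Real.log R| ≤ Θ) :
    R ^ a ≤ Real.exp Θ * R ^ c := by
  rw [Real.rpow_def_of_pos hR, Real.rpow_def_of_pos hR, ← Real.exp_add]
  apply Real.exp_le_exp.2
  have h1 : Real.log R * (a - c) ≤ |a - c| * |Real.log R| := by
    rw [← abs_mul, mul_comm]; exact le_abs_self _
  linarith

/-- Since `1 / R ≤ K / dist x y`, the number `|log R|` is at most a constant times `log (e + 1 /
dist x y)`, which is exactly the denominator of the log-Hölder bound. The condition `R ≤ δ` takes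
care of large radii. -/
theorem LogHolderWith.osc_mul_log_le {X : Type*} [MetricSpace X] {f : X → ℝ} {L : ℝ}
    (hf : LogHolderWith L f) (hL : 0 ≤ L) {K R δ : ℝ} (hK : 1 ≤ K) (hR : 0 < R) (hRδ : R ≤ δ)
    {x y : X} (hxy : dist x y ≤ K * R) :
    |f x - f y| * |Real.log R| ≤ L * (Real.log K + 1 + |Real.log δ|) := by
  have hK0 : 0 < K := by linarith
  have hlK : 0 ≤ Real.log K := Real.log_nonneg hK
  have hrhs : 0 ≤ L * (Real.log K + 1 + |Real.log δ|) := by positivity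
  rcases eq_or_ne x y with rfl | hne
  · simpa using hrhs
  have hd : 0 < dist x y := dist_pos.2 hne
  set T := Real.log (Real.exp 1 + 1 / dist x y) with hT
  have h1T : 1 ≤ T := by
    rw [hT, Real.le_log_iff_exp_le (by positivity)]
    have : 0 ≤ 1 / dist x y := by positivity
    linarith
  have hlog : |Real.log R| ≤ (Real.log K + 1 + |Real.log δ|) * T := by
    have hb : |Real.log R| ≤ Real.log K + T + |Real.log δ| := by
      rw [abs_le]
      constructor
      · have h2 : 1 / R ≤ K * (Real.exp 1 + 1 / dist x y) := by
          have : 1 / R ≤ K * (1 / dist x y) := by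
            rw [mul_one_div, div_le_div_iff₀ hR hd]; linarith
          have h3 : 0 ≤ K * Real.exp 1 := by positivity
          nlinarith
        have h4 := Real.log_le_log (by positivity) h2
        rw [Real.log_mul hK0.ne' (by positivity), one_div, Real.log_inv] at h4
        have := abs_nonneg (Real.log δ)
        linarith
      · have := Real.log_le_log hR hRδ
        have := le_abs_self (Real.log δ)
        linarith
    have := abs_nonneg (Real.log δ)
    nlinarith
  calc |f x - f y| * |Real.log R|
      ≤ (L / T) * ((Real.log K + 1 + |Real.log δ|) * T) :=
        mul_le_mul (hf x y) hlog (abs_nonneg _) (by positivity)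
    _ = L * (Real.log K + 1 + |Real.log δ|) := by field_simp

theorem LogHolderWith.continuous {X : Type*} [MetricSpace X] {f : X → ℝ} {L : ℝ}
    (hf : LogHolderWith L f) : Continuous f := by
  rw [continuous_iff_continuousAt]
  intro x
  rw [continuousAt_iff_punctured_nhds, tendsto_iff_dist_tendsto_zero]
  have hlim : Filter.Tendsto (fun y => L / Real.log (Real.exp 1 + 1 / dist y x))
      (nhdsWithin x {x}ᶜ) (nhds 0) := by
    apply Filter.Tendsto.const_div_atTop
    apply Real.tendsto_log_atTop.comp
    apply Filter.tendsto_atTop_add_const_left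
    simp only [one_div]
    apply Filter.Tendsto.inv_tendsto_nhdsGT_zero
    rw [tendsto_nhdsWithin_iff]
    refine ⟨?_, ?_⟩
    · have : Continuous fun y => dist y x := by fun_prop
      have h := this.tendsto x
      rw [dist_self] at h
      exact h.mono_left nhdsWithin_le_nhds
    · filter_upwards [self_mem_nhdsWithin] with y hy
      exact dist_pos.2 hy
  exact squeeze_zero (fun _ => dist_nonneg) (fun y => by rw [Real.dist_eq]; exact hf y x) hlim

theorem continuous_of_logHolder_one_div {X : Type*} [MetricSpace X] {f : X → ℝ} {L : ℝ}
    (hf : LogHolderWith L (fun x => 1 / f x)) (hpos : ∀ x, 0 < f x) : Continuous f := by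
  have : f = fun x => (1 / f x)⁻¹ := by ext x; simp
  rw [this]
  exact hf.continuous.inv₀ fun x => (one_div_pos.2 (hpos x)).ne'

/-- Exponents which satisfy the bounds of `ControlledBy` at every point. -/
structure RegularExponents {X : Type*} [MetricSpace X] (Λ : ℝ) (Q p ε : X → ℝ) : Prop where
  one_le : 1 ≤ Λ
  le_Q : ∀ x, Λ⁻¹ ≤ Q x
  Q_le : ∀ x, Q x ≤ Λ
  le_p : ∀ x, Λ⁻¹ ≤ p x
  p_le : ∀ x, p x ≤ Λ
  le_ε : ∀ x, Λ⁻¹ ≤ ε x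
  ε_le : ∀ x, ε x ≤ Λ
  log_Q : LogHolderWith Λ (fun x => 1 / Q x)
  log_p : LogHolderWith Λ (fun x => 1 / p x)
  log_ε : LogHolderWith Λ (fun x => 1 / ε x)

theorem abs_sub_le_sq_mul_abs_one_div_sub {Λ a c : ℝ} (ha : 0 < a) (hc : 0 < c) (haΛ : a ≤ Λ)
    (hcΛ : c ≤ Λ) : |a - c| ≤ Λ ^ 2 * |1 / a - 1 / c| := by
  have h : a - c = -(a * c) * (1 / a - 1 / c) := by field_simp; ring
  rw [h, abs_mul, abs_neg, abs_of_pos (mul_pos ha hc)]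
  gcongr
  nlinarith

namespace RegularExponents

variable {X : Type*} [MetricSpace X] {Λ : ℝ} {Q p ε : X → ℝ}

theorem pos (h : RegularExponents Λ Q p ε) : 0 < Λ := zero_lt_one.trans_le h.one_le

theorem Q_pos (h : RegularExponents Λ Q p ε) (x : X) : 0 < Q x :=
  (inv_pos.2 h.pos).trans_le (h.le_Q x)

theorem p_pos (h : RegularExponents Λ Q p ε) (x : X) : 0 < p x :=
  (inv_pos.2 h.pos).trans_le (h.le_p x)

theorem ε_pos (h : RegularExponents Λ Q p ε) (x : X) : 0 < ε x :=
  (inv_pos.2 h.pos).trans_le (h.le_ε x)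

theorem one_div_p_le (h : RegularExponents Λ Q p ε) (x : X) : 1 / p x ≤ Λ := by
  rw [one_div]; exact inv_le_of_inv_le₀ h.pos (h.le_p x)

theorem Q_div_p_nonneg (h : RegularExponents Λ Q p ε) (x : X) : 0 ≤ Q x / p x :=
  div_nonneg (h.Q_pos x).le (h.p_pos x).le

theorem Q_div_p_le (h : RegularExponents Λ Q p ε) (x : X) : Q x / p x ≤ Λ ^ 2 := by
  have h1 := h.one_div_p_le x
  have h2 := h.Q_le x
  have h3 := h.Q_pos x
  have : Q x / p x = Q x * (1 / p x) := by ring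
  rw [this, pow_two]
  exact mul_le_mul h2 h1 (one_div_nonneg.2 (h.p_pos x).le) h.pos.le

theorem continuous_Q (h : RegularExponents Λ Q p ε) : Continuous Q :=
  continuous_of_logHolder_one_div h.log_Q h.Q_pos

theorem continuous_p (h : RegularExponents Λ Q p ε) : Continuous p :=
  continuous_of_logHolder_one_div h.log_p h.p_pos

theorem continuous_ε (h : RegularExponents Λ Q p ε) : Continuous ε :=
  continuous_of_logHolder_one_div h.log_ε h.ε_pos

theorem continuous_holderExp (h : RegularExponents Λ Q p ε) : Continuous (holderExp Q p ε) :=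
  h.continuous_ε.sub (h.continuous_Q.div h.continuous_p fun x => (h.p_pos x).ne')

end RegularExponents

/-- Powers of a radius with exponents taken at points at a comparable distance are comparable. -/
theorem exists_rpow_comparison (Λ δ K : ℝ) (hΛ : 1 ≤ Λ) (hK : 1 ≤ K) :
    ∃ C : ℝ, 1 ≤ C ∧ ∀ (X : Type w) [MetricSpace X] (Q p ε : X → ℝ),
      RegularExponents Λ Q p ε → ∀ (x y : X) (R : ℝ), 0 < R → R ≤ δ → dist x y ≤ K * R →
        R ^ ε x ≤ C * R ^ ε y ∧ R ^ Q x ≤ C * R ^ Q y ∧ R ^ (-Q x) ≤ C * R ^ (-Q y) ∧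
        R ^ (-(Q x / p x)) ≤ C * R ^ (-(Q y / p y)) ∧
        R ^ (-(Q y / p x)) ≤ C * R ^ (-(Q y / p y)) ∧
        R ^ holderExp Q p ε x ≤ C * R ^ holderExp Q p ε y := by
  set M := Λ * (Real.log K + 1 + |Real.log δ|) with hM
  have hM0 : 0 ≤ M := by have := Real.log_nonneg hK; positivity
  have hΛ0 : 0 < Λ := by linarith
  -- The exponent dominates all oscillations below, each multiplied by `|log R|`: `Λ ^ 2 * M` for
  -- `Q` and `ε`, `Λ * M` for `Q y / p` (only `p` varies), `(Λ ^ 3 + Λ) * M` for `Q / p`, and their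
  -- sum for `holderExp`.
  refine ⟨Real.exp ((Λ ^ 3 + Λ ^ 2 + Λ) * M), Real.one_le_exp (by positivity), ?_⟩
  intro X _ Q p ε h x y R hR hRδ hxy
  have oQ := h.log_Q.osc_mul_log_le hΛ0.le hK hR hRδ hxy
  have op := h.log_p.osc_mul_log_le hΛ0.le hK hR hRδ hxy
  have oε := h.log_ε.osc_mul_log_le hΛ0.le hK hR hRδ hxy
  simp only [← hM] at oQ op oε
  set l := |Real.log R| with hl
  have hl0 : 0 ≤ l := abs_nonneg _
  have eQ : |Q x - Q y| * l ≤ Λ ^ 2 * M := by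
    have := abs_sub_le_sq_mul_abs_one_div_sub (h.Q_pos x) (h.Q_pos y) (h.Q_le x) (h.Q_le y)
    calc _ ≤ (Λ ^ 2 * |1 / Q x - 1 / Q y|) * l := by gcongr
      _ = Λ ^ 2 * (|1 / Q x - 1 / Q y| * l) := by ring
      _ ≤ _ := by gcongr
  have eε : |ε x - ε y| * l ≤ Λ ^ 2 * M := by
    have := abs_sub_le_sq_mul_abs_one_div_sub (h.ε_pos x) (h.ε_pos y) (h.ε_le x) (h.ε_le y)
    calc _ ≤ (Λ ^ 2 * |1 / ε x - 1 / ε y|) * l := by gcongr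
      _ = Λ ^ 2 * (|1 / ε x - 1 / ε y| * l) := by ring
      _ ≤ _ := by gcongr
  have ep : |Q y / p x - Q y / p y| * l ≤ Λ * M := by
    have : Q y / p x - Q y / p y = Q y * (1 / p x - 1 / p y) := by ring
    rw [this, abs_mul, abs_of_pos (h.Q_pos y), mul_assoc]
    exact mul_le_mul (h.Q_le y) op (by positivity) hΛ0.le
  have eQp : |Q x / p x - Q y / p y| * l ≤ (Λ ^ 3 + Λ) * M := by
    have e1 : Q x / p x - Q y / p y = (Q x - Q y) * (1 / p x) + (Q y / p x - Q y / p y) := by ring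
    have e2 : |Q x / p x - Q y / p y| ≤ |Q x - Q y| * Λ + |Q y / p x - Q y / p y| := by
      rw [e1]
      refine (abs_add_le _ _).trans ?_
      rw [abs_mul, abs_of_pos (one_div_pos.2 (h.p_pos x))]
      gcongr
      exact h.one_div_p_le x
    calc _ ≤ (|Q x - Q y| * Λ + |Q y / p x - Q y / p y|) * l := by gcongr
      _ = Λ * (|Q x - Q y| * l) + |Q y / p x - Q y / p y| * l := by ring
      _ ≤ Λ * (Λ ^ 2 * M) + Λ * M := by gcongr
      _ = _ := by ring
  have p1 : 0 ≤ Λ * M := by positivity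
  have p2 : 0 ≤ Λ ^ 2 * M := by positivity
  have p3 : 0 ≤ Λ ^ 3 * M := by positivity
  refine ⟨rpow_le_exp_mul_rpow hR ?_, rpow_le_exp_mul_rpow hR ?_, rpow_le_exp_mul_rpow hR ?_,
    rpow_le_exp_mul_rpow hR ?_, rpow_le_exp_mul_rpow hR ?_, rpow_le_exp_mul_rpow hR ?_⟩
  · rw [← hl]; linarith
  · rw [← hl]; linarith
  · rw [← hl, neg_sub_neg, abs_sub_comm]; linarith
  · rw [← hl, neg_sub_neg, abs_sub_comm]; linarith
  · rw [← hl, neg_sub_neg, abs_sub_comm]; linarith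
  · rw [← hl]
    have e1 : |holderExp Q p ε x - holderExp Q p ε y| ≤ |ε x - ε y| + |Q x / p x - Q y / p y| := by
      have : holderExp Q p ε x - holderExp Q p ε y = (ε x - ε y) - (Q x / p x - Q y / p y) := by
        simp only [holderExp]; ring
      rw [this]; exact abs_sub _ _
    calc _ ≤ (|ε x - ε y| + |Q x / p x - Q y / p y|) * l := by gcongr
      _ ≤ _ := by linarith

/-! ### Chains of good points -/

/-- A function `U` with a Hajłasz gradient `lam * H` of variable order `ε` on the set `S`, which
meets every ball `B(x, R) ⊆ E` in a point where `H ^ p ≤ A * R ^ (-Q x)`. -/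
structure HajlaszData {X : Type*} [MetricSpace X] (Λ δ A lam : ℝ) (Q p ε : X → ℝ) (E S : Set X)
    (U H : X → ℝ) : Prop where
  exps : RegularExponents Λ Q p ε
  lam_nonneg : 0 ≤ lam
  H_nonneg : ∀ x, 0 ≤ H x
  ineq : ∀ x ∈ S, ∀ y ∈ S, |U x - U y| ≤ lam * (dist x y ^ ε x * H x + dist x y ^ ε y * H y)
  point : ∀ (x : X) (R : ℝ), 0 < R → R ≤ δ → Metric.ball x R ⊆ E →
    ∃ z ∈ S, dist z x < R ∧ H z ^ p z ≤ A * R ^ (-Q x)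

/-- Taking the root of order `p z` in `point` produces the exponent `Q x / p z`; since `z` lies
within `R` of `x`, log-Hölder continuity replaces `p z` by `p x`. -/
theorem exists_good_point (Λ δ A : ℝ) (hΛ : 1 ≤ Λ) (hA : 1 ≤ A) :
    ∃ G : ℝ, 1 ≤ G ∧ ∀ (X : Type w) [MetricSpace X] (Q p ε : X → ℝ) (E S : Set X) (U H : X → ℝ)
      (lam : ℝ), HajlaszData Λ δ A lam Q p ε E S U H → ∀ (x : X) (R : ℝ), 0 < R → R ≤ δ →
      Metric.ball x R ⊆ E → ∃ z ∈ S, dist z x < R ∧ H z ≤ G * R ^ (-(Q x / p x)) := by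
  obtain ⟨C, hC, hcomp⟩ := exists_rpow_comparison.{w} Λ δ 1 hΛ le_rfl
  have hAL : 1 ≤ A ^ Λ := Real.one_le_rpow hA (by linarith)
  refine ⟨A ^ Λ * C, one_le_mul_of_one_le_of_one_le hAL hC, ?_⟩
  intro X _ Q p ε E S U H lam h x R hR hRδ hsub
  obtain ⟨z, hz, hzx, hHz⟩ := h.point x R hR hRδ hsub
  refine ⟨z, hz, hzx, ?_⟩
  have hpz := h.exps.p_pos z
  have h1 : H z ≤ (A * R ^ (-Q x)) ^ (1 / p z) := by
    rw [one_div, Real.le_rpow_inv_iff_of_pos (h.H_nonneg z) (by positivity) hpz]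
    exact hHz
  have h2 := (hcomp X Q p ε h.exps z x R hR hRδ (by linarith)).2.2.2.2.1
  calc H z ≤ (A * R ^ (-Q x)) ^ (1 / p z) := h1
    _ = A ^ (1 / p z) * R ^ (-(Q x / p z)) := by
        rw [Real.mul_rpow (by linarith) (by positivity), ← Real.rpow_mul hR.le]
        congr 2; ring
    _ ≤ A ^ Λ * (C * R ^ (-(Q x / p x))) := by
        gcongr
        exact h.exps.one_div_p_le z
    _ = _ := by ring

theorem rpow_mul_rpow_eq_holderExp {X : Type*} {Q p ε : X → ℝ} {R : ℝ} (hR : 0 < R) (x : X) :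
    R ^ ε x * R ^ (-(Q x / p x)) = R ^ holderExp Q p ε x := by
  rw [← Real.rpow_add hR]; rfl

/-- All four points lie within a multiple of `R`, so each term is at most a constant times `R ^ ε x
* R ^ (-(Q x / p x))`. With `a` and `b` the values of `H` at good points `z` and `w`, this bounds
one link of a chain. -/
theorem exists_two_point_bound (Λ δ K G : ℝ) (hΛ : 1 ≤ Λ) (hK : 1 ≤ K) (hG : 1 ≤ G) :
    ∃ C : ℝ, 1 ≤ C ∧ ∀ (X : Type w) [MetricSpace X] (Q p ε : X → ℝ),
      RegularExponents Λ Q p ε → ∀ (x y z w : X) (R a b : ℝ), 0 < R → R ≤ δ →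
      dist x y ≤ K * R → dist z x ≤ R → dist w y ≤ R →
      a ≤ G * R ^ (-(Q x / p x)) → b ≤ G * R ^ (-(Q y / p y)) →
      dist z w ^ ε z * a + dist z w ^ ε w * b ≤ C * R ^ holderExp Q p ε x := by
  obtain ⟨C, hC, hcomp⟩ := exists_rpow_comparison.{w} Λ δ (K + 1) hΛ (by linarith)
  have hKL : 1 ≤ (K + 2) ^ Λ := Real.one_le_rpow (by linarith) (by linarith)
  set M := (K + 2) ^ Λ with hM
  refine ⟨2 * (M * C * (G * C)), ?_, ?_⟩
  · have h1 : 1 ≤ M * C := one_le_mul_of_one_le_of_one_le hKL hC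
    have h2 : 1 ≤ G * C := one_le_mul_of_one_le_of_one_le hG hC
    have := one_le_mul_of_one_le_of_one_le h1 h2
    linarith
  intro X _ Q p ε h x y z w R a b hR hRδ hxy hzx hwy ha hb
  have hKR : 0 ≤ K * R := by positivity
  have hzw : dist z w ≤ (K + 2) * R := by
    have h1 := dist_triangle4 z x y w
    rw [dist_comm y w] at h1
    linarith
  have hwx : dist w x ≤ (K + 1) * R := by
    have h1 := dist_triangle w y x
    rw [dist_comm y x] at h1
    linarith
  have key : ∀ v, dist v x ≤ (K + 1) * R → dist z w ^ ε v ≤ M * C * R ^ ε x := by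
    intro v hv
    calc dist z w ^ ε v ≤ ((K + 2) * R) ^ ε v :=
          Real.rpow_le_rpow dist_nonneg hzw (h.ε_pos v).le
      _ = (K + 2) ^ ε v * R ^ ε v := Real.mul_rpow (by linarith) hR.le
      _ ≤ M * (C * R ^ ε x) := by
          gcongr
          · exact Real.rpow_le_rpow_of_exponent_le (by linarith) (h.ε_le v)
          · exact (hcomp X Q p ε h v x R hR hRδ hv).1
      _ = _ := by ring
  have hz := key z (by linarith)
  have hw := key w hwx
  have hb' : b ≤ G * C * R ^ (-(Q x / p x)) := by
    have := (hcomp X Q p ε h y x R hR hRδ (by rw [dist_comm]; linarith)).2.2.2.1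
    calc b ≤ _ := hb
      _ ≤ G * (C * R ^ (-(Q x / p x))) := by gcongr
      _ = _ := by ring
  have hP : 0 ≤ R ^ (-(Q x / p x)) := by positivity
  have ha' : a ≤ G * C * R ^ (-(Q x / p x)) := by
    refine ha.trans ?_
    gcongr
    nlinarith
  have e := rpow_mul_rpow_eq_holderExp (Q := Q) (p := p) (ε := ε) hR x
  have hrhs : 0 ≤ G * C * R ^ (-(Q x / p x)) := by positivity
  have hd : ∀ v, 0 ≤ dist z w ^ ε v := fun v => Real.rpow_nonneg dist_nonneg _
  calc dist z w ^ ε z * a + dist z w ^ ε w * b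
      ≤ (M * C * R ^ ε x) * (G * C * R ^ (-(Q x / p x)))
        + (M * C * R ^ ε x) * (G * C * R ^ (-(Q x / p x))) := by
        apply add_le_add
        · exact (mul_le_mul_of_nonneg_left ha' (hd z)).trans (mul_le_mul_of_nonneg_right hz hrhs)
        · exact (mul_le_mul_of_nonneg_left hb' (hd w)).trans (mul_le_mul_of_nonneg_right hw hrhs)
    _ = 2 * (M * C * (G * C)) * (R ^ ε x * R ^ (-(Q x / p x))) := by ring
    _ = _ := by rw [e]

/-- Consecutive good points of the balls `B(x, R / 2 ^ j)` differ in `U` by a multiple of `lam * (R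
/ 2 ^ j) ^ α`, and these differences telescope. The link from `x` to the last good point involves `H
x`, which has no bound; the free number `n` makes its coefficient as small as wanted. -/
theorem exists_chain_bound (Λ δ A : ℝ) (hΛ : 1 ≤ Λ) (hA : 1 ≤ A) :
    ∃ C G : ℝ, 1 ≤ C ∧ 1 ≤ G ∧ ∀ (X : Type w) [MetricSpace X] (Q p ε : X → ℝ) (E S : Set X)
      (U H : X → ℝ) (lam : ℝ), HajlaszData Λ δ A lam Q p ε E S U H → ∀ x ∈ S, ∀ R : ℝ, 0 < R →
      R ≤ δ → Metric.ball x R ⊆ E →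
      ∃ z ∈ S, dist z x < R ∧ H z ≤ G * R ^ (-(Q x / p x)) ∧
        ∀ n : ℕ, |U x - U z| ≤ lam * (C * ((R / 2 ^ n) ^ ε x * H x +
          ∑ j ∈ Finset.range (n + 1), (R / 2 ^ j) ^ holderExp Q p ε x)) := by
  obtain ⟨G, hG, hgood⟩ := exists_good_point.{w} Λ δ A hΛ hA
  have hL : (1 : ℝ) ≤ 2 ^ (Λ ^ 2) := Real.one_le_rpow (by norm_num) (by positivity)
  -- A link joins a good point at radius `R / 2 ^ n` to one at half that radius. Measuring both at
  -- the larger radius costs `2 ^ (Q x / p x) ≤ 2 ^ (Λ ^ 2)`.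
  have hG' : 1 ≤ G * 2 ^ (Λ ^ 2) := one_le_mul_of_one_le_of_one_le hG hL
  obtain ⟨C, hC, htwo⟩ := exists_two_point_bound.{w} Λ δ 1 (G * 2 ^ (Λ ^ 2)) hΛ le_rfl hG'
  refine ⟨C, G, hC, hG, ?_⟩
  intro X _ Q p ε E S U H lam h x hx R hR hRδ hsub
  have hr : ∀ n : ℕ, 0 < R / 2 ^ n := fun n => by positivity
  have hrR : ∀ n : ℕ, R / 2 ^ n ≤ R := fun n =>
    div_le_self hR.le (one_le_pow₀ (by norm_num))
  have hz : ∀ n : ℕ, ∃ z ∈ S, dist z x < R / 2 ^ n ∧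
      H z ≤ G * (R / 2 ^ n) ^ (-(Q x / p x)) := fun n =>
    hgood X Q p ε E S U H lam h x _ (hr n) ((hrR n).trans hRδ)
      ((Metric.ball_subset_ball (hrR n)).trans hsub)
  choose z hzS hzd hzH using hz
  refine ⟨z 0, hzS 0, by simpa using hzd 0, by simpa using hzH 0, ?_⟩
  have hzH' : ∀ n, H (z n) ≤ G * 2 ^ (Λ ^ 2) * (R / 2 ^ n) ^ (-(Q x / p x)) := fun n => by
    refine (hzH n).trans ?_
    have := hr n
    gcongr
    nlinarith
  have hstep : ∀ n, |U (z n) - U (z (n + 1))| ≤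
      lam * (C * (R / 2 ^ n) ^ holderExp Q p ε x) := by
    intro n
    refine (h.ineq _ (hzS n) _ (hzS (n + 1))).trans
      (mul_le_mul_of_nonneg_left ?_ h.lam_nonneg)
    have hle : R / 2 ^ (n + 1) ≤ R / 2 ^ n := by
      rw [pow_succ]; gcongr; nlinarith [pow_pos (zero_lt_two' ℝ) n]
    refine htwo X Q p ε h.exps x x _ _ (R / 2 ^ n) _ _ (hr n) ((hrR n).trans hRδ)
      (by rw [dist_self, one_mul]; exact (hr n).le) (hzd n).le
      ((hzd (n + 1)).le.trans hle) (hzH' n) ((hzH (n + 1)).trans ?_)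
    have e : R / 2 ^ (n + 1) = (R / 2 ^ n) * 2⁻¹ := by rw [pow_succ]; field_simp
    rw [e, Real.mul_rpow (hr n).le (by norm_num), Real.inv_rpow (by norm_num),
      Real.rpow_neg (by norm_num : (0 : ℝ) ≤ 2), inv_inv, mul_comm ((R / 2 ^ n) ^ _), ← mul_assoc]
    have := hr n
    gcongr
    · norm_num
    · exact h.exps.Q_div_p_le x
  have htele : ∀ n, |U (z 0) - U (z n)| ≤
      lam * (C * ∑ j ∈ Finset.range n, (R / 2 ^ j) ^ holderExp Q p ε x) := by
    intro n
    induction n with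
    | zero => simp
    | succ n ih =>
      rw [Finset.sum_range_succ]
      have := abs_sub_le (U (z 0)) (U (z n)) (U (z (n + 1)))
      have := hstep n
      linarith
  intro n
  have hlast : |U x - U (z n)| ≤
      lam * (C * ((R / 2 ^ n) ^ ε x * H x) + C * (R / 2 ^ n) ^ holderExp Q p ε x) := by
    refine (h.ineq _ hx _ (hzS n)).trans (mul_le_mul_of_nonneg_left ?_ h.lam_nonneg)
    have hd : dist x (z n) ≤ R / 2 ^ n := by rw [dist_comm]; exact (hzd n).le
    have h0 : dist x (z n) ^ ε x * H x ≤ C * ((R / 2 ^ n) ^ ε x * H x) := by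
      have h1 : dist x (z n) ^ ε x * H x ≤ (R / 2 ^ n) ^ ε x * H x :=
        mul_le_mul_of_nonneg_right (Real.rpow_le_rpow dist_nonneg hd (h.exps.ε_pos x).le)
          (h.H_nonneg x)
      refine h1.trans (le_mul_of_one_le_left ?_ hC)
      exact mul_nonneg (Real.rpow_nonneg (hr n).le _) (h.H_nonneg x)
    -- The value `0` in place of `H x` isolates the contribution of `z n`; the contribution of `x`
    -- is kept apart in `h0`.
    have h2 := htwo X Q p ε h.exps x x x (z n) (R / 2 ^ n) 0 (H (z n)) (hr n)
      ((hrR n).trans hRδ) (by rw [dist_self, one_mul]; exact (hr n).le)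
      (by rw [dist_self]; exact (hr n).le) (hzd n).le
      (by have := hr n; positivity) (hzH' n)
    linarith
  have := abs_sub_le (U x) (U (z n)) (U (z 0))
  have h3 := htele n
  rw [abs_sub_comm] at h3
  rw [Finset.sum_range_succ]
  linarith

/-- The chain bound on a ball, with one common reference value. -/
theorem exists_common_chain_bound (Λ δ A σ : ℝ) (hΛ : 1 ≤ Λ) (hA : 1 ≤ A) (hσ : 1 < σ) :
    ∃ C : ℝ, 1 ≤ C ∧ ∀ (X : Type w) [MetricSpace X] (Q p ε : X → ℝ) (x₀ : X) (r₀ : ℝ) (S : Set X)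
      (U H : X → ℝ) (lam : ℝ), 0 < r₀ → r₀ ≤ δ / σ →
      HajlaszData Λ δ A lam Q p ε (Metric.ball x₀ (σ * r₀)) S U H →
      ∃ c : ℝ, ∀ x ∈ S ∩ Metric.ball x₀ r₀, ∀ n : ℕ,
        |U x - c| ≤ lam * (C * (((σ - 1) * r₀ / 2 ^ n) ^ ε x * H x +
          ∑ j ∈ Finset.range (n + 1), ((σ - 1) * r₀ / 2 ^ j) ^ holderExp Q p ε x)) := by
  obtain ⟨C, G, hC, hG, hchain⟩ := exists_chain_bound.{w} Λ δ A hΛ hA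
  obtain ⟨G', hG', hgood⟩ := exists_good_point.{w} Λ δ A hΛ hA
  obtain ⟨C', hC', htwo⟩ := exists_two_point_bound.{w} Λ δ (1 + 1 / (σ - 1)) (G + G') hΛ
    (by have : 0 < 1 / (σ - 1) := one_div_pos.2 (by linarith)
        linarith) (by linarith)
  refine ⟨C + C', by linarith, ?_⟩
  intro X _ Q p ε x₀ r₀ S U H lam hr₀ hr₀δ h
  have hσ1 : 0 < σ - 1 := by linarith
  -- For `x ∈ B₀` this radius keeps `B(x, R)` inside `σB₀`; also `R + r₀ = (1 + 1 / (σ - 1)) * R`,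
  -- so the centres `x` and `x₀` are at a distance comparable to `R`.
  set R := (σ - 1) * r₀ with hR
  have hR0 : 0 < R := mul_pos hσ1 hr₀
  have hRσ : R ≤ σ * r₀ := by rw [hR]; nlinarith
  have hRδ : R ≤ δ := by
    rw [le_div_iff₀ (by linarith)] at hr₀δ
    linarith
  obtain ⟨v, hvS, hvd, hvH⟩ := hgood X Q p ε _ S U H lam h x₀ R hR0 hRδ
    (Metric.ball_subset_ball hRσ)
  refine ⟨U v, fun x hx n => ?_⟩
  have hxd : dist x x₀ < r₀ := hx.2
  obtain ⟨z, hzS, hzd, hzH, hz⟩ := hchain X Q p ε _ S U H lam h x hx.1 R hR0 hRδ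
    (Metric.ball_subset_ball' (by rw [hR]; linarith))
  have h1 := h.ineq z hzS v hvS
  have h2 := htwo X Q p ε h.exps x x₀ z v R (H z) (H v) hR0 hRδ
    (by
      have : (1 + 1 / (σ - 1)) * R = R + r₀ := by rw [hR]; field_simp
      rw [this]; linarith) hzd.le hvd.le
    (hzH.trans (by gcongr; linarith)) (hvH.trans (by gcongr; linarith))
  have h3 := hz n
  have h4 := abs_sub_le (U x) (U z) (U v)
  -- The cost of passing from the good point near `x` to the common one near `x₀` is absorbed by the
  -- summand `j = 0`.
  have h5 : R ^ holderExp Q p ε x ≤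
      ∑ j ∈ Finset.range (n + 1), (R / 2 ^ j) ^ holderExp Q p ε x := by
    have := Finset.single_le_sum (f := fun j : ℕ => (R / 2 ^ j) ^ holderExp Q p ε x)
      (s := Finset.range (n + 1)) (fun j _ => by positivity) (Finset.mem_range.2 n.succ_pos)
    simpa using this
  have h6 : 0 ≤ (R / 2 ^ n) ^ ε x * H x := mul_nonneg (by positivity) (h.H_nonneg x)
  have h7 : |U z - U v| ≤ lam * (C' * ((R / 2 ^ n) ^ ε x * H x +
      ∑ j ∈ Finset.range (n + 1), (R / 2 ^ j) ^ holderExp Q p ε x)) := by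
    refine h1.trans (mul_le_mul_of_nonneg_left (h2.trans ?_) h.lam_nonneg)
    gcongr
    linarith
  calc |U x - U v| ≤ _ := h4
    _ ≤ _ := add_le_add h3 h7
    _ = _ := by ring

/-! ### From almost everywhere bounds to pointwise bounds -/

theorem IsMetricMeasure.isOpenPosMeasure {X : Type*} [MetricSpace X] [MeasurableSpace X]
    {μ : Measure X} (h : IsMetricMeasure μ) : μ.IsOpenPosMeasure where
  open_pos U hU hne := by
    obtain ⟨x, hx⟩ := hne
    obtain ⟨r, hr, hsub⟩ := Metric.isOpen_iff.1 hU x hx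
    exact ((h x r hr).1.trans_le (measure_mono hsub)).ne'

/-- The set where the inequality fails is open and null, hence empty because balls have positive
measure. -/
theorem forall_le_of_ae_le {X : Type*} [MetricSpace X] [MeasurableSpace X] {μ : Measure X}
    (h : IsMetricMeasure μ) {f g : X → ℝ} (hf : Continuous f) (hg : Continuous g)
    (hfg : ∀ᵐ x ∂μ, f x ≤ g x) (x : X) : f x ≤ g x := by
  have := h.isOpenPosMeasure
  have ho : IsOpen {x | g x < f x} := isOpen_lt hg hf
  have h0 : μ {x | g x < f x} = 0 := by
    rw [ae_iff] at hfg; simpa using hfg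
  rw [ho.measure_eq_zero_iff μ] at h0
  by_contra hc
  have : x ∈ {x | g x < f x} := not_le.1 hc
  simp [h0] at this

/-- `Q`, `p` and `ε` are continuous, so their essential bounds hold everywhere. Comparing the two
bounds of `Q` at `x₀` forces `1 ≤ Λ`; this is the only use of the point. -/
theorem Setting.regularExponents {X : Type*} [MetricSpace X] [MeasurableSpace X]
    {μ : Measure X} {b δ Λ : ℝ} {Q p ε s : X → ℝ} (h : Setting b δ Λ μ Q p ε s) (hΛ : 0 < Λ)
    (x₀ : X) : RegularExponents Λ Q p ε := by
  have hc := h.controlled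
  have hQ := continuous_of_logHolder_one_div hc.log_Q h.Q_mem.pos
  have hp := continuous_of_logHolder_one_div hc.log_p h.p_mem.pos
  have hε := continuous_of_logHolder_one_div hc.log_ε h.ε_mem.pos
  have lo : ∀ {f : X → ℝ}, Continuous f → EssBetween μ Λ⁻¹ Λ f → ∀ x, Λ⁻¹ ≤ f x := fun hf hb =>
    forall_le_of_ae_le h.metricMeasure continuous_const hf (hb.mono fun _ hx => hx.1)
  have hi : ∀ {f : X → ℝ}, Continuous f → EssBetween μ Λ⁻¹ Λ f → ∀ x, f x ≤ Λ := fun hf hb =>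
    forall_le_of_ae_le h.metricMeasure hf continuous_const (hb.mono fun _ hx => hx.2)
  refine ⟨?_, lo hQ hc.bounds_Q, hi hQ hc.bounds_Q, lo hp hc.bounds_p, hi hp hc.bounds_p,
    lo hε hc.bounds_ε, hi hε hc.bounds_ε, hc.log_Q, hc.log_p, hc.log_ε⟩
  have h1 := (lo hQ hc.bounds_Q x₀).trans (hi hQ hc.bounds_Q x₀)
  by_contra hlt
  have := (one_lt_inv₀ hΛ).2 (not_le.1 hlt)
  linarith

/-! ### The mixed quasi-norm -/

section Mixed

variable {X : Type*} [MetricSpace X] [MeasurableSpace X] {μ : Measure X} {E : Set X}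
  {p : X → ℝ} {q : X → ℝ≥0∞} {g : ℤ → X → ℝ≥0∞}

theorem modular_mono_ae (hp : ∀ x, 0 ≤ p x) {f₁ f₂ : X → ℝ≥0∞}
    (h : ∀ᵐ x ∂μ.restrict E, f₁ x ≤ f₂ x) : modular μ E p f₁ ≤ modular μ E p f₂ :=
  lintegral_mono_ae (h.mono fun x hx => ENNReal.rpow_le_rpow hx (hp x))

theorem IsExponentOn.exists_inv_bound (hq : IsExponentOn μ E q) :
    ∃ M : ℝ, 0 < M ∧ ∀ᵐ x ∂μ.restrict E, ((q x)⁻¹).toReal ≤ M := by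
  -- The minimum with `1` keeps `m` finite when the essential infimum is infinite, as for `q = ∞`.
  set m := min (essInf q (μ.restrict E)) 1 with hm
  have hm0 : 0 < m := lt_min hq.essInf_pos one_pos
  have hm1 : m ≠ ∞ := ((min_le_right _ _).trans_lt ENNReal.one_lt_top).ne
  have hi : m⁻¹ ≠ ∞ := ENNReal.inv_ne_top.2 hm0.ne'
  refine ⟨m⁻¹.toReal, ENNReal.toReal_pos (ENNReal.inv_ne_zero.2 hm1) hi, ?_⟩
  filter_upwards [ae_essInf_le (f := q) (μ := μ.restrict E)] with x hx
  exact ENNReal.toReal_mono hi (ENNReal.inv_le_inv.2 ((min_le_left _ _).trans hx))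

/-- Here `q` disappears. Every summand of the mixed modular is at most `1`, so each `k` has an
admissible `l'` below any `η > 1`. The choice `η = 2 ^ (1 / M)`, with `1 / q ≤ M`, turns `l' ^ (1 /
q)` into at most `2`, uniformly in `k`. -/
theorem exists_modular_le_one_of_mixedNorm_lt (hp : ∀ x, 0 ≤ p x) (hq : IsExponentOn μ E q)
    {lam : ℝ} (h : mixedNorm μ E p q g < ENNReal.ofReal lam) :
    ∃ l : ℝ, 0 < l ∧ l ≤ lam ∧
      ∀ k, modular μ E p (fun x => g k x / ENNReal.ofReal (2 * l)) ≤ 1 := by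
  obtain ⟨M, hM, hqM⟩ := hq.exists_inv_bound
  simp only [mixedNorm, iInf_lt_iff] at h
  obtain ⟨l, hl, hmod, hlt⟩ := h
  refine ⟨l, hl, (ENNReal.ofReal_lt_ofReal_iff_of_nonneg hl.le).1 hlt |>.le, fun k => ?_⟩
  set η : ℝ := 2 ^ (M⁻¹) with hη
  have hη1 : 1 < η := Real.one_lt_rpow (by norm_num) (inv_pos.2 hM)
  have hηM : η ^ M = 2 := by
    rw [hη, ← Real.rpow_mul (by norm_num), inv_mul_cancel₀ hM.ne', Real.rpow_one]
  have hk := ((ENNReal.le_tsum k).trans hmod).trans_lt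
    (show (1 : ℝ≥0∞) < ENNReal.ofReal η by rwa [ENNReal.one_lt_ofReal])
  simp only [iInf_lt_iff] at hk
  obtain ⟨l', hl', hmod', hlt'⟩ := hk
  have hl'η : l' ≤ η := ((ENNReal.ofReal_lt_ofReal_iff_of_nonneg hl'.le).1 hlt').le
  refine (modular_mono_ae hp ?_).trans hmod'
  filter_upwards [hqM] with x hx
  rw [mul_comm, ENNReal.ofReal_mul hl.le, div_eq_mul_inv, ENNReal.mul_inv (by simp) (by simp),
    ← mul_assoc, ← div_eq_mul_inv, ← div_eq_mul_inv]
  refine ENNReal.div_le_div_left (ENNReal.ofReal_le_ofReal ?_) _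
  calc l' ^ ((q x)⁻¹).toReal ≤ η ^ ((q x)⁻¹).toReal :=
        Real.rpow_le_rpow hl'.le hl'η ENNReal.toReal_nonneg
    _ ≤ η ^ M := Real.rpow_le_rpow_of_exponent_le hη1.le hx
    _ = 2 := hηM

theorem modular_div_le {Λ : ℝ} (hΛ : 0 < Λ) (hp : ∀ x, Λ⁻¹ ≤ p x) {f : X → ℝ≥0∞} {c : ℝ} (hc : 1 ≤ c) :
    modular μ E p (fun x => f x / ENNReal.ofReal c) ≤
      ENNReal.ofReal ((c⁻¹) ^ (Λ⁻¹)) * modular μ E p f := by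
  have hc0 : 0 < c := by linarith
  have hc1 : c⁻¹ ≤ 1 := inv_le_one_of_one_le₀ hc
  rw [modular, modular, ← lintegral_const_mul' _ _ ENNReal.ofReal_ne_top]
  refine lintegral_mono fun x => ?_
  have hpx : 0 ≤ p x := (inv_pos.2 hΛ).le.trans (hp x)
  rw [div_eq_mul_inv, ← ENNReal.ofReal_inv_of_pos hc0, ENNReal.mul_rpow_of_nonneg _ _ hpx,
    ENNReal.ofReal_rpow_of_pos (inv_pos.2 hc0), mul_comm]
  exact mul_le_mul_left (ENNReal.ofReal_le_ofReal
    (Real.rpow_le_rpow_of_exponent_ge (inv_pos.2 hc0) hc1 (hp x))) _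

/-- The `k`-th summand of the modular of `g / lam`. -/
noncomputable def mixedTerm (μ : Measure X) (E : Set X) (p : X → ℝ) (q : X → ℝ≥0∞)
    (g : ℤ → X → ℝ≥0∞) (lam : ℝ) (k : ℤ) : ℝ≥0∞ :=
  ⨅ (t : ℝ) (_ : 0 < t) (_ : modular μ E p (fun x => g k x / ENNReal.ofReal lam /
      ENNReal.ofReal (t ^ ((q x)⁻¹).toReal)) ≤ 1), ENNReal.ofReal t

theorem tsum_le_sum_add_tsum {ι : Type*} (f : ι → ℝ≥0∞) (F : Finset ι) {a c : ℝ≥0∞}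
    (h₁ : ∑ k ∈ F, f k ≤ a) (h₂ : ∑' k : {k // k ∉ F}, f k ≤ c) : ∑' k, f k ≤ a + c := by
  rw [← ENNReal.sum_add_tsum_compl F f]
  exact add_le_add (h₁ : ∑ k ∈ F, f k ≤ a) (h₂ : ∑' k : {k // k ∉ F}, f k ≤ c)

theorem mixedNorm_le {lam : ℝ} (hlam : 0 < lam) (h : ∑' k, mixedTerm μ E p q g lam k ≤ 1) :
    mixedNorm μ E p q g ≤ ENNReal.ofReal lam :=
  iInf_le_of_le lam (iInf_le_of_le hlam (iInf_le_of_le h le_rfl))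

/-- Membership only asks for a finite modular at some `l`, whereas the quasi-norm needs modular at
most `1`. The terms outside a finite set sum to less than `1 / 2` and do not grow with `lam`; each
of the finitely many others becomes small for large `lam` because `g k` has finite `p`-modular. -/
theorem MemMixed.mixedNorm_lt_top {Λ : ℝ} (hΛ : 0 < Λ) (hp : ∀ x, Λ⁻¹ ≤ p x)
    (hq : IsExponentOn μ E q) (hg : MemMixed μ E p q g) : mixedNorm μ E p q g < ∞ := by
  have hp0 : ∀ x, 0 ≤ p x := fun x => (inv_pos.2 hΛ).le.trans (hp x)
  obtain ⟨M, hM, hqM⟩ := hq.exists_inv_bound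
  obtain ⟨l, hl, hfin⟩ := hg.finite
  have hT : ∀ lam k, l ≤ lam → mixedTerm μ E p q g lam k ≤ mixedTerm μ E p q g l k := by
    intro lam k hlam
    refine iInf_mono fun t => iInf_mono fun ht => iInf_mono' fun h => ⟨?_, le_rfl⟩
    refine (modular_mono_ae hp0 (Filter.Eventually.of_forall fun x => ?_)).trans h
    gcongr
  have htail : ∃ F : Finset ℤ, ∑' k : {k // k ∉ F}, mixedTerm μ E p q g l k < 2⁻¹ :=
    ((tendsto_order.1 (ENNReal.tendsto_tsum_compl_atTop_zero
      (show ∑' k, mixedTerm μ E p q g l k ≠ ∞ from hfin.ne))).2 _ (by simp)).exists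
  obtain ⟨F, hF⟩ := htail
  obtain ⟨τ, hτ0, hτ1, hτF⟩ : ∃ τ : ℝ, 0 < τ ∧ τ ≤ 1 ∧ F.card * τ ≤ 2⁻¹ := by
    have : (0 : ℝ) ≤ F.card := Nat.cast_nonneg _
    refine ⟨(2 * (F.card + 1))⁻¹, by positivity, inv_le_one_of_one_le₀ (by linarith), ?_⟩
    rw [mul_inv_le_iff₀ (by positivity)]
    linarith
  have hlim : ∀ k, ∃ L : ℝ, ∀ lam, L ≤ lam → mixedTerm μ E p q g lam k ≤ ENNReal.ofReal τ := by
    intro k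
    obtain ⟨m, hm0, hm'⟩ : ∃ m : ℝ, 0 ≤ m ∧ modular μ E p (g k) = ENNReal.ofReal m :=
      ⟨_, ENNReal.toReal_nonneg, (ENNReal.ofReal_toReal (hg.memLp k).ne).symm⟩
    have hmΛ : 1 ≤ (m + 1) ^ Λ := Real.one_le_rpow (by linarith) hΛ.le
    -- Makes `t = τ` admissible: `τ ^ (1 / q) ≥ τ ^ M` since `τ ≤ 1`, and division by `lam * τ ^ M ≥
    -- (m + 1) ^ Λ` shrinks the modular `m` at least by the factor `m + 1`.
    refine ⟨(m + 1) ^ Λ / τ ^ M, fun lam hlam => ?_⟩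
    have hτM : 0 < τ ^ M := Real.rpow_pos_of_pos hτ0 _
    have hc : (m + 1) ^ Λ ≤ lam * τ ^ M := by rwa [div_le_iff₀ hτM] at hlam
    have hc1 : 1 ≤ lam * τ ^ M := hmΛ.trans hc
    have hlam0 : 0 < lam := pos_of_mul_pos_left (by linarith) hτM.le
    refine iInf_le_of_le τ (iInf_le_of_le hτ0 (iInf_le_of_le ?_ le_rfl))
    calc _ ≤ modular μ E p (fun x => g k x / ENNReal.ofReal (lam * τ ^ M)) := by
          refine modular_mono_ae hp0 ?_
          filter_upwards [hqM] with x hx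
          rw [ENNReal.ofReal_mul hlam0.le, div_eq_mul_inv (g k x) (_ * _),
            ENNReal.mul_inv (by simp [hlam0]) (by simp),
            ← mul_assoc, ← div_eq_mul_inv, ← div_eq_mul_inv]
          refine ENNReal.div_le_div_left (ENNReal.ofReal_le_ofReal ?_) _
          exact Real.rpow_le_rpow_of_exponent_ge hτ0 hτ1 hx
      _ ≤ _ := modular_div_le hΛ hp hc1
      _ ≤ 1 := by
          rw [hm', ← ENNReal.ofReal_mul (Real.rpow_nonneg (inv_nonneg.2 (by linarith)) _),
            ENNReal.ofReal_le_one,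
            Real.inv_rpow (by linarith),
            inv_mul_le_iff₀ (Real.rpow_pos_of_pos (by linarith) _), mul_one]
          have : m + 1 ≤ (lam * τ ^ M) ^ (Λ⁻¹) := by
            rw [Real.le_rpow_inv_iff_of_pos (by linarith) (by linarith) hΛ]
            exact hc
          linarith
  choose L hL using hlim
  obtain ⟨lam, hlam⟩ : ∃ lam, ∀ k ∈ F, L k ≤ lam := by
    obtain ⟨c, hc⟩ := (F.image L).bddAbove
    exact ⟨c, fun k hk => hc (by simpa using ⟨k, hk, rfl⟩)⟩
  obtain ⟨lam', hl', hlam''⟩ : ∃ lam', l ≤ lam' ∧ lam ≤ lam' :=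
    ⟨max l lam, le_max_left _ _, le_max_right _ _⟩
  refine (mixedNorm_le (hl.trans_le hl') ?_).trans_lt ENNReal.ofReal_lt_top
  have h1 : ∑ k ∈ F, mixedTerm μ E p q g lam' k ≤ 2⁻¹ := by
    calc ∑ k ∈ F, mixedTerm μ E p q g lam' k ≤ ∑ k ∈ F, ENNReal.ofReal τ :=
          Finset.sum_le_sum fun k hk => hL k _ ((hlam k hk).trans hlam'')
      _ = ENNReal.ofReal (F.card * τ) := by
          rw [Finset.sum_const, nsmul_eq_mul, ENNReal.ofReal_mul (Nat.cast_nonneg _),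
            ENNReal.ofReal_natCast]
      _ ≤ ENNReal.ofReal 2⁻¹ := by
          exact ENNReal.ofReal_le_ofReal hτF
      _ = 2⁻¹ := by rw [ENNReal.ofReal_inv_of_pos (by norm_num)]; simp
  have h2 : ∑' k : {k // k ∉ F}, mixedTerm μ E p q g lam' k ≤ 2⁻¹ := by
    refine le_trans ?_ hF.le
    exact ENNReal.tsum_le_tsum fun k => hT lam' k hl'
  exact (tsum_le_sum_add_tsum _ F h1 h2).trans ENNReal.inv_two_add_inv_two.le

end Mixed

/-! ### Reduction to a single Hajłasz gradient -/

/-- For `k ≥ 0` this is `d ≤ 2 ^ (-k)`. For `k < 0` the bound `d ≤ D` allows only `2 ^ |k| ≤ 2 * D`: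
the factor `(1 + 2 * D) ^ Λ` controls `d ^ t`, and `(1 + 2 * D) ^ Λ⁻¹` compensates the decaying
weight. -/
theorem rpow_le_geometric_weight {Λ D d t : ℝ} {k : ℤ} (hΛ : 1 ≤ Λ) (hd : 0 < d) (hdD : d ≤ D)
    (h1 : (2 : ℝ) ^ (-k - 1) ≤ d) (h2 : d < (2 : ℝ) ^ (-k)) (ht : Λ⁻¹ ≤ t) (htΛ : t ≤ Λ) :
    d ^ t ≤ (1 + 2 * D) ^ (Λ + Λ⁻¹) * ((2 : ℝ) ^ (-Λ⁻¹)) ^ k.natAbs := by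
  have hΛ0 : 0 < Λ := by linarith
  have hΛi : 0 < Λ⁻¹ := inv_pos.2 hΛ0
  have hD0 : 0 < D := by linarith
  rw [← Real.rpow_natCast, ← Real.rpow_mul (by norm_num)]
  rcases le_or_gt 0 k with hk | hk
  · have hkn : ((k.natAbs : ℕ) : ℝ) = (k : ℝ) := by
      rw [Nat.cast_natAbs, abs_of_nonneg hk]
    have hk' : (0 : ℝ) ≤ k := by exact_mod_cast hk
    have e : (2 : ℝ) ^ (-k) = 2 ^ (-(k : ℝ)) := by rw [← Int.cast_neg, Real.rpow_intCast]
    have hC : 1 ≤ (1 + 2 * D) ^ (Λ + Λ⁻¹) := Real.one_le_rpow (by linarith) (by linarith)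
    have hd1 : d ≤ 1 := h2.le.trans (by
      rw [e]; exact Real.rpow_le_one_of_one_le_of_nonpos (by norm_num) (by linarith))
    calc d ^ t ≤ d ^ Λ⁻¹ := Real.rpow_le_rpow_of_exponent_ge hd hd1 ht
      _ ≤ (2 ^ (-(k : ℝ))) ^ Λ⁻¹ := Real.rpow_le_rpow hd.le (e ▸ h2.le) hΛi.le
      _ = 2 ^ (-Λ⁻¹ * (k.natAbs : ℕ)) := by
          rw [← Real.rpow_mul (by norm_num), hkn]; congr 1; ring
      _ ≤ _ := le_mul_of_one_le_left (by positivity) hC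
  · have hkn : ((k.natAbs : ℕ) : ℝ) = -(k : ℝ) := by
      rw [Nat.cast_natAbs, abs_of_neg hk, Int.cast_neg]
    have e : (2 : ℝ) ^ (-k - 1) = 2 ^ (-(k : ℝ) - 1) := by
      rw [← Real.rpow_intCast]; push_cast; rfl
    have hd1 : 1 ≤ d := h1.trans' (one_le_zpow₀ (by norm_num) (by omega))
    have h3 : (2 : ℝ) ^ (-(k : ℝ)) ≤ 1 + 2 * D := by
      have h4 : (2 : ℝ) ^ (-(k : ℝ)) = 2 * 2 ^ (-(k : ℝ) - 1) := by
        rw [Real.rpow_sub_one (by norm_num)]; ring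
      rw [h4, ← e]; linarith
    have hB : 0 < 1 + 2 * D := by linarith
    rw [hkn, Real.rpow_add hB]
    have h5 : (1 : ℝ) ≤ (1 + 2 * D) ^ Λ⁻¹ * 2 ^ (-Λ⁻¹ * -(k : ℝ)) := by
      have : (2 : ℝ) ^ (-Λ⁻¹ * -(k : ℝ)) = ((2 ^ (-(k : ℝ))) ^ Λ⁻¹)⁻¹ := by
        rw [← Real.rpow_mul (by norm_num), ← Real.rpow_neg (by norm_num)]; congr 1; ring
      rw [this, ← div_eq_mul_inv, one_le_div (by positivity)]
      exact Real.rpow_le_rpow (by positivity) h3 hΛi.le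
    calc d ^ t ≤ d ^ Λ := Real.rpow_le_rpow_of_exponent_le hd1 htΛ
      _ ≤ (1 + 2 * D) ^ Λ := Real.rpow_le_rpow hd.le (by linarith) hΛ0.le
      _ ≤ _ := by
          rw [mul_assoc]
          exact le_mul_of_one_le_right (by positivity) h5

theorem summable_pow_natAbs {r : ℝ} (h0 : 0 ≤ r) (h1 : r < 1) :
    Summable fun k : ℤ => r ^ k.natAbs := by
  refine Summable.of_nat_of_neg ?_ ?_ <;> simpa using summable_geometric_of_lt_one h0 h1

theorem abs_coe_sub_coe (a c : ℝ) : ((a : EReal) - (c : EReal)).abs = ENNReal.ofReal |a - c| := by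
  rw [← EReal.coe_sub, EReal.abs_def]

/-- A point of a ball at which a function is bounded by its mean over the ball. -/
theorem exists_point_le_mean {X : Type*} [MetricSpace X] [MeasurableSpace X] [BorelSpace X]
    {μ : Measure X} (hμ : IsMetricMeasure μ) {f : X → ℝ≥0∞} {E N : Set X} (hf : AEMeasurable f (μ.restrict E))
    (hN : μ N = 0) {A₀ m : ℝ} (hA : ∫⁻ x in E, f x ∂μ ≤ ENNReal.ofReal A₀) {x : X} {R : ℝ}
    (hR : 0 < R) (hsub : Metric.ball x R ⊆ E) (hm : 0 < m)
    (hmμ : ENNReal.ofReal m ≤ μ (Metric.ball x R)) :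
    ∃ z ∈ Metric.ball x R, z ∉ N ∧ f z ≤ ENNReal.ofReal (A₀ / m) := by
  have hB := hμ x R hR
  have : IsFiniteMeasure (μ.restrict (Metric.ball x R)) :=
    ⟨by rw [Measure.restrict_apply_univ]; exact hB.2⟩
  have hBm : MeasurableSet (Metric.ball x R) := Metric.isOpen_ball.measurableSet
  have hnull : (μ.restrict (Metric.ball x R)) (N ∪ (Metric.ball x R)ᶜ) = 0 := by
    refine measure_union_null (Measure.absolutelyContinuous_of_le Measure.restrict_le_self hN) ?_
    rw [Measure.restrict_apply hBm.compl, Set.compl_inter_self, measure_empty]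
  obtain ⟨z, hz, hfz⟩ := exists_notMem_null_le_laverage
    (μ := μ.restrict (Metric.ball x R)) (by simpa using hB.1.ne')
    (hf.mono_measure (Measure.restrict_mono hsub le_rfl)) hnull
  simp only [Set.mem_union, Set.mem_compl_iff, not_or, not_not] at hz
  refine ⟨z, hz.2, hz.1, hfz.trans ?_⟩
  rw [setLAverage_eq, ENNReal.ofReal_div_of_pos hm]
  exact ENNReal.div_le_div ((lintegral_mono_set hsub).trans hA) hmμ

/-- `H ^ p` is the sum over `k` of the `p`-th powers of the weighted, normalised `g k`. Its integral
is a geometric series because each normalised `g k` has modular at most one. A single summand never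
exceeds the sum, so `H` dominates every weighted `g k` and serves all scales at once. Lower
regularity turns the integral bound into the good points. -/
theorem exists_gradient_majorant (b δ σ Λ : ℝ) (hb : 0 < b) (hδ : 0 < δ) (hσ : 1 < σ)
    (hΛ : 0 < Λ) :
    ∃ A : ℝ, 1 ≤ A ∧ ∀ (X : Type w) [MetricSpace X] [MeasurableSpace X] [BorelSpace X]
      (μ : Measure X) (Q p ε s : X → ℝ), Setting b δ Λ μ Q p ε s →
      ∀ (x₀ : X) (r₀ : ℝ) (q : X → ℝ≥0∞) (u : X → EReal) (g : ℤ → X → ℝ≥0∞),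
        LocalData δ σ μ p s x₀ r₀ q u g → ∀ lam : ℝ,
        mixedNorm μ (Metric.ball x₀ (σ * r₀)) p q g < ENNReal.ofReal lam →
        ∃ (S : Set X) (H : X → ℝ), HajlaszData Λ δ A (2 * lam) Q p ε (Metric.ball x₀ (σ * r₀)) S
            (fun x => (u x).toReal) H ∧
          (∀ᵐ x ∂μ.restrict (Metric.ball x₀ (σ * r₀)), x ∈ S) ∧
          (∀ x ∈ S, u x = ((u x).toReal : EReal)) ∧
          ∫⁻ x in Metric.ball x₀ (σ * r₀), ENNReal.ofReal (H x ^ p x) ∂μ ≤ ENNReal.ofReal A := by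
  by_cases hΛ1 : 1 ≤ Λ
  swap
  -- For `Λ < 1` no setting on a nonempty space exists, so any constant will do.
  · refine ⟨1, le_rfl, fun X _ _ _ μ Q p ε s hset x₀ => ?_⟩
    exact absurd (hset.regularExponents hΛ x₀).one_le hΛ1
  have hΛi : 0 < Λ⁻¹ := inv_pos.2 hΛ
  set C₁ : ℝ := (1 + 2 * (2 * δ)) ^ (Λ + Λ⁻¹) with hC₁
  have hC₁1 : 1 ≤ C₁ := Real.one_le_rpow (by linarith) (by linarith)
  set ω : ℝ := 2 ^ (-Λ⁻¹) with hω
  have hω0 : 0 < ω := Real.rpow_pos_of_pos (by norm_num) _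
  have hω1 : ω < 1 := Real.rpow_lt_one_of_one_lt_of_neg (by norm_num) (by linarith)
  set θ : ℝ := ω ^ Λ⁻¹ with hθ
  have hθ0 : 0 < θ := Real.rpow_pos_of_pos hω0 _
  have hθ1 : θ < 1 := Real.rpow_lt_one hω0.le hω1 hΛi
  have hsum : Summable fun k : ℤ => C₁ ^ Λ * θ ^ k.natAbs :=
    (summable_pow_natAbs hθ0.le hθ1).mul_left _
  set A₀ : ℝ := ∑' k : ℤ, C₁ ^ Λ * θ ^ k.natAbs with hA₀
  have hA₀0 : 0 ≤ A₀ := tsum_nonneg fun k => by positivity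
  -- `A₀` bounds the integral of `H ^ p`, `A₀ / b` enters at the good points, and `1` ensures `1 ≤
  -- A`.
  refine ⟨1 + A₀ + A₀ / b, by have := div_nonneg hA₀0 hb.le; linarith, ?_⟩
  intro X _ _ _ μ Q p ε s hset x₀ r₀ q u g hloc lam hlam
  have hexp := hset.regularExponents hΛ x₀
  have hp0 : ∀ x, 0 < p x := hexp.p_pos
  set E := Metric.ball x₀ (σ * r₀) with hE
  have hEm : MeasurableSet E := Metric.isOpen_ball.measurableSet
  obtain ⟨l, hl, hllam, hmod⟩ :=
    exists_modular_le_one_of_mixedNorm_lt (fun x => (hp0 x).le) hloc.q_mem hlam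
  let a : ℤ → X → ℝ≥0∞ := fun k x =>
    ENNReal.ofReal (C₁ * ω ^ k.natAbs) * (g k x / ENNReal.ofReal (2 * l))
  let F : X → ℝ≥0∞ := fun x => ∑' k, a k x ^ p x
  have hpm : AEMeasurable p (μ.restrict E) := hset.p_mem.measurable.aemeasurable
  have ham : ∀ k, AEMeasurable (fun x => a k x ^ p x) (μ.restrict E) := fun k =>
    (((aemeasurable_restrict_of_measurable_subtype hEm (hloc.g_grad.measurable k)).div_const
      _).const_mul _).pow hpm
  have hFm : AEMeasurable F (μ.restrict E) := AEMeasurable.tsum ham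
  have hterm : ∀ k, ∫⁻ x in E, a k x ^ p x ∂μ ≤ ENNReal.ofReal (C₁ ^ Λ * θ ^ k.natAbs) := by
    intro k
    have hw0 : 0 < ω ^ k.natAbs := pow_pos hω0 _
    have hw1 : ω ^ k.natAbs ≤ 1 := pow_le_one₀ hω0.le hω1.le
    calc ∫⁻ x in E, a k x ^ p x ∂μ
        ≤ ∫⁻ x in E, ENNReal.ofReal (C₁ ^ Λ * θ ^ k.natAbs) *
            (g k x / ENNReal.ofReal (2 * l)) ^ p x ∂μ := by
          refine lintegral_mono fun x => ?_
          simp only [a]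
          rw [ENNReal.mul_rpow_of_nonneg _ _ (hp0 x).le,
            ENNReal.ofReal_rpow_of_pos (by positivity)]
          refine mul_le_mul_left (ENNReal.ofReal_le_ofReal ?_) _
          rw [Real.mul_rpow (by positivity) hw0.le]
          have h1 : C₁ ^ p x ≤ C₁ ^ Λ := Real.rpow_le_rpow_of_exponent_le hC₁1 (hexp.p_le x)
          have h2 : (ω ^ k.natAbs) ^ p x ≤ θ ^ k.natAbs := by
            calc (ω ^ k.natAbs) ^ p x ≤ (ω ^ k.natAbs) ^ Λ⁻¹ :=
                  Real.rpow_le_rpow_of_exponent_ge hw0 hw1 (hexp.le_p x)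
              _ = θ ^ k.natAbs := by
                  rw [hθ, ← Real.rpow_natCast, ← Real.rpow_natCast, ← Real.rpow_mul hω0.le,
                    ← Real.rpow_mul hω0.le, mul_comm]
          gcongr
      _ = ENNReal.ofReal (C₁ ^ Λ * θ ^ k.natAbs) *
            modular μ E p (fun x => g k x / ENNReal.ofReal (2 * l)) :=
          lintegral_const_mul' _ _ ENNReal.ofReal_ne_top
      _ ≤ ENNReal.ofReal (C₁ ^ Λ * θ ^ k.natAbs) * 1 := by
          gcongr
          exact hmod k
      _ = _ := mul_one _
  have hFint : ∫⁻ x in E, F x ∂μ ≤ ENNReal.ofReal A₀ := by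
    rw [lintegral_tsum ham, hA₀, ENNReal.ofReal_tsum_of_nonneg (fun k => by positivity) hsum]
    exact ENNReal.tsum_le_tsum hterm
  have hFfin : ∀ᵐ x ∂μ.restrict E, F x < ∞ :=
    ae_lt_top' hFm (hFint.trans_lt ENNReal.ofReal_lt_top).ne
  obtain ⟨N, hN0, hN⟩ := hloc.g_grad.ineq
  let P : X → Prop := fun x => x ∉ N ∧ F x < ∞ ∧ (u x ≠ ⊤ ∧ u x ≠ ⊥) ∧
    (Λ⁻¹ ≤ s x - ε x ∧ s x ≤ Λ)
  have hP : ∀ᵐ x ∂μ.restrict E, P x := by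
    have hN' : ∀ᵐ x ∂μ.restrict E, x ∉ N := ae_restrict_of_ae (measure_eq_zero_iff_ae_notMem.1 hN0)
    filter_upwards [hN', hFfin, hloc.u_mem.ae_finite, ae_restrict_of_ae hset.controlled.gap,
      ae_restrict_of_ae hset.controlled.bounds_s] with x h1 h2 h3 h4 h5
    exact ⟨h1, h2, h3, h4, h5.2⟩
  let H : X → ℝ := fun x => (F x).toReal ^ (1 / p x)
  have hHp : ∀ x, H x ^ p x = (F x).toReal := fun x => by
    simp only [H]
    rw [← Real.rpow_mul ENNReal.toReal_nonneg, one_div_mul_cancel (hp0 x).ne', Real.rpow_one]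
  have hδσ : σ * r₀ ≤ δ := by
    have := hloc.radius_le
    rw [le_div_iff₀ (by linarith)] at this
    linarith
  refine ⟨{x | x ∈ E ∧ P x}, H, ⟨hexp, by linarith, fun x => Real.rpow_nonneg ENNReal.toReal_nonneg _,
    ?_, ?_⟩, ?_, ?_, ?_⟩
  · rintro x ⟨hxE, hxN, hxF, hxu, hxs⟩ y ⟨hyE, hyN, hyF, hyu, hys⟩
    have hH0 : ∀ x, 0 ≤ H x := fun x => Real.rpow_nonneg ENNReal.toReal_nonneg _
    rcases eq_or_ne x y with rfl | hne
    · have := mul_nonneg (Real.rpow_nonneg (dist_nonneg (x := x) (y := x)) (ε x)) (hH0 x)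
      rw [sub_self, abs_zero]
      exact mul_nonneg (by linarith) (by linarith)
    have hd : 0 < dist x y := dist_pos.2 hne
    have hdD : dist x y ≤ 2 * δ := by
      have h1 : dist x x₀ < σ * r₀ := hxE
      have h2 : dist y x₀ < σ * r₀ := hyE
      have := dist_triangle_right x y x₀
      linarith
    obtain ⟨n, hn1, hn2⟩ := exists_mem_Ico_zpow hd (one_lt_two (α := ℝ))
    -- Reindexing matches the interval `[2 ^ n, 2 ^ (n + 1))` with the scale convention of vector
    -- gradients.
    obtain ⟨k, rfl⟩ : ∃ k : ℤ, n = -k - 1 := ⟨-n - 1, by ring⟩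
    rw [show -k - 1 + 1 = -k by ring] at hn2
    have key : ∀ z, F z < ∞ → (Λ⁻¹ ≤ s z - ε z ∧ s z ≤ Λ) →
        ENNReal.ofReal (dist x y ^ s z) * g k z ≤
          ENNReal.ofReal (2 * lam * (dist x y ^ ε z * H z)) := by
      intro z hzF hzs
      have hw := rpow_le_geometric_weight hΛ1 hd hdD hn1 hn2 hzs.1
        (by have := hexp.ε_pos z; linarith [hzs.2])
      have haH : a k z ≤ ENNReal.ofReal (H z) := by
        have h1 : a k z ^ p z ≤ ENNReal.ofReal (H z ^ p z) := by
          rw [hHp, ENNReal.ofReal_toReal hzF.ne]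
          exact ENNReal.le_tsum k
        rw [← ENNReal.ofReal_rpow_of_nonneg (hH0 z) (hp0 z).le] at h1
        exact (ENNReal.rpow_le_rpow_iff (hp0 z)).1 h1
      have hg : g k z = ENNReal.ofReal (2 * l) * (g k z / ENNReal.ofReal (2 * l)) :=
        (ENNReal.mul_div_cancel (by simpa using hl) ENNReal.ofReal_ne_top).symm
      calc ENNReal.ofReal (dist x y ^ s z) * g k z
          ≤ ENNReal.ofReal (dist x y ^ ε z * (C₁ * ω ^ k.natAbs)) * g k z := by
            refine mul_le_mul_left (ENNReal.ofReal_le_ofReal ?_) _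
            calc dist x y ^ s z = dist x y ^ ε z * dist x y ^ (s z - ε z) := by
                  rw [← Real.rpow_add hd]; congr 1; ring
              _ ≤ _ := by gcongr
        _ = ENNReal.ofReal (2 * l) * (ENNReal.ofReal (dist x y ^ ε z) * a k z) := by
            rw [ENNReal.ofReal_mul (by positivity)]
            nth_rewrite 1 [hg]
            simp only [a]
            ring
        _ ≤ ENNReal.ofReal (2 * lam) * (ENNReal.ofReal (dist x y ^ ε z) * ENNReal.ofReal (H z)) := by
            gcongr
        _ = _ := by
            rw [← ENNReal.ofReal_mul (by positivity), ← ENNReal.ofReal_mul (by linarith)]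
    have h := hN k x ⟨hxE, hxN⟩ y ⟨hyE, hyN⟩ hn1 hn2
    rw [← EReal.coe_toReal hxu.1 hxu.2, ← EReal.coe_toReal hyu.1 hyu.2, abs_coe_sub_coe] at h
    have h' := h.trans (add_le_add (key x hxF hxs) (key y hyF hys))
    have hn : ∀ z, 0 ≤ 2 * lam * (dist x y ^ ε z * H z) := fun z =>
      mul_nonneg (by linarith) (mul_nonneg (by positivity) (hH0 z))
    rw [← ENNReal.ofReal_add (hn x) (hn y),
      ENNReal.ofReal_le_ofReal_iff (add_nonneg (hn x) (hn y))] at h'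
    linarith
  · intro x R hR hRδ hsub
    have hm : 0 < b * R ^ Q x := by positivity
    have hPN : μ {z | z ∈ E ∧ ¬ P z} = 0 := by
      have := (ae_restrict_iff' hEm).1 hP
      rw [ae_iff] at this
      simpa only [Classical.not_imp] using this
    obtain ⟨z, hzx, hzN, hzF⟩ := exists_point_le_mean hset.metricMeasure hFm hPN hFint hR hsub hm
      (hset.lowerRegular x R hR hRδ)
    have hzP : P z := by
      by_contra hc
      exact hzN ⟨hsub hzx, hc⟩
    refine ⟨z, ⟨hsub hzx, hzP⟩, hzx, ?_⟩
    rw [hHp]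
    have h1 : (F z).toReal ≤ A₀ / (b * R ^ Q x) :=
      ENNReal.toReal_le_of_le_ofReal (by positivity) hzF
    calc (F z).toReal ≤ A₀ / (b * R ^ Q x) := h1
      _ = A₀ / b * R ^ (-Q x) := by rw [Real.rpow_neg hR.le]; field_simp
      _ ≤ _ := by gcongr; linarith
  · filter_upwards [hP, ae_restrict_mem hEm] with x h1 h2
    exact ⟨h2, h1⟩
  · rintro x ⟨-, -, -, hxu, -⟩
    exact (EReal.coe_toReal hxu.1 hxu.2).symm
  · calc ∫⁻ x in E, ENNReal.ofReal (H x ^ p x) ∂μ = ∫⁻ x in E, F x ∂μ := by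
          refine lintegral_congr_ae ?_
          filter_upwards [hFfin] with x hx
          rw [hHp, ENNReal.ofReal_toReal hx.ne]
      _ ≤ ENNReal.ofReal A₀ := hFint
      _ ≤ _ := ENNReal.ofReal_le_ofReal (by have := div_nonneg hA₀0 hb.le; linarith)

/-! ### Dyadic sums and elementary inequalities -/

/-- Halving the radius multiplies a summand by at least `2 ^ κ`, so the sum is a geometric series
read backwards from its last term. -/
theorem sum_dyadic_rpow_le_last {R α κ : ℝ} (hR : 0 < R) (hκ : 0 < κ) (hα : α ≤ -κ) (n : ℕ) :
    ∑ j ∈ Finset.range (n + 1), (R / 2 ^ j) ^ α ≤ (1 - 2 ^ (-κ))⁻¹ * (R / 2 ^ n) ^ α := by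
  have hθ1 : (2 : ℝ) ^ (-κ) < 1 := Real.rpow_lt_one_of_one_lt_of_neg (by norm_num) (by linarith)
  have hθ0 : 0 < (2 : ℝ) ^ (-κ) := by positivity
  set θ : ℝ := 2 ^ (-κ) with hθ
  have hD : (1 - θ)⁻¹ * θ + 1 = (1 - θ)⁻¹ := by
    have : 1 - θ ≠ 0 := by linarith
    field_simp; ring
  have hD0 : 0 < (1 - θ)⁻¹ := inv_pos.2 (by linarith)
  induction n with
  | zero =>
    have h0 : 0 < R ^ α := by positivity
    have : 1 ≤ (1 - θ)⁻¹ := one_le_inv_iff₀.2 ⟨by linarith, by linarith⟩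
    simpa using le_mul_of_one_le_left h0.le this
  | succ n ih =>
    rw [Finset.sum_range_succ]
    have hr : 0 < R / 2 ^ (n + 1) := by positivity
    have h1 : (R / 2 ^ n) ^ α ≤ θ * (R / 2 ^ (n + 1)) ^ α := by
      have e : R / 2 ^ n = 2 * (R / 2 ^ (n + 1)) := by rw [pow_succ]; field_simp
      rw [e, Real.mul_rpow (by norm_num) hr.le]
      gcongr
      exact Real.rpow_le_rpow_of_exponent_le (by norm_num) hα
    calc _ ≤ (1 - θ)⁻¹ * (θ * (R / 2 ^ (n + 1)) ^ α) + (R / 2 ^ (n + 1)) ^ α := by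
          gcongr
          exact ih.trans (by gcongr)
      _ = ((1 - θ)⁻¹ * θ + 1) * (R / 2 ^ (n + 1)) ^ α := by ring
      _ = _ := by rw [hD]

theorem sum_dyadic_rpow_le_first {R α κ : ℝ} (hR : 0 < R) (hκ : 0 < κ) (hα : κ ≤ α) (n : ℕ) :
    ∑ j ∈ Finset.range n, (R / 2 ^ j) ^ α ≤ (1 - 2 ^ (-κ))⁻¹ * R ^ α := by
  have hθ1 : (2 : ℝ) ^ (-κ) < 1 := Real.rpow_lt_one_of_one_lt_of_neg (by norm_num) (by linarith)
  have hθ0 : 0 < (2 : ℝ) ^ (-κ) := by positivity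
  set θ : ℝ := 2 ^ (-κ) with hθ
  calc ∑ j ∈ Finset.range n, (R / 2 ^ j) ^ α ≤ ∑ j ∈ Finset.range n, θ ^ j * R ^ α := by
        refine Finset.sum_le_sum fun j _ => ?_
        have e : (R / 2 ^ j) ^ α = ((2 : ℝ) ^ (-α)) ^ j * R ^ α := by
          rw [Real.div_rpow hR.le (by positivity), ← Real.rpow_natCast, ← Real.rpow_natCast,
            ← Real.rpow_mul (by norm_num), ← Real.rpow_mul (by norm_num), div_eq_mul_inv,
            ← Real.rpow_neg (by norm_num), mul_comm]
          congr 2; ring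
        rw [e]
        gcongr
        rw [hθ]
        exact Real.rpow_le_rpow_of_exponent_le (by norm_num) (by linarith)
    _ = (∑ j ∈ Finset.range n, θ ^ j) * R ^ α := by rw [Finset.sum_mul]
    _ ≤ _ := by
        gcongr
        rw [← tsum_geometric_of_lt_one hθ0.le hθ1]
        exact (summable_geometric_of_lt_one hθ0.le hθ1).sum_le_tsum _ fun j _ => by positivity

theorem exists_dyadic_radius {t R : ℝ} (ht : 0 < t) (htR : t ≤ R) :
    ∃ n : ℕ, R / 2 ^ (n + 1) ≤ t ∧ t ≤ R / 2 ^ n := by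
  obtain ⟨n, h1, h2⟩ := exists_nat_pow_near ((one_le_div ht).2 htR) (one_lt_two (α := ℝ))
  refine ⟨n, ?_, ?_⟩
  · rw [div_le_iff₀ (by positivity)]
    rw [div_lt_iff₀ ht] at h2
    linarith
  · rw [le_div_iff₀ (by positivity)]
    rw [le_div_iff₀ ht] at h1
    linarith

/-- Passes from every `lam` above the quasi-norm to the quasi-norm itself, the values `0` and `∞`
included. -/
theorem le_mul_of_forall_lt_ofReal {a n c : ℝ≥0∞} (hc : c ≠ 0) (hc' : c ≠ ∞)
    (h : ∀ lam : ℝ, n < ENNReal.ofReal lam → a ≤ c * ENNReal.ofReal lam) : a ≤ c * n := by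
  by_contra hlt
  rw [not_le, mul_comm, ← ENNReal.lt_div_iff_mul_lt (Or.inl hc) (Or.inl hc')] at hlt
  obtain ⟨r, -, h1, h2⟩ := ENNReal.lt_iff_exists_real_btwn.1 hlt
  rw [ENNReal.lt_div_iff_mul_lt (Or.inl hc) (Or.inl hc'), mul_comm] at h2
  exact absurd (h r h1) (not_le.2 h2)

theorem add_rpow_le_two_rpow_mul {a c γ : ℝ} (ha : 0 ≤ a) (hc : 0 ≤ c) (hγ : 0 ≤ γ) :
    (a + c) ^ γ ≤ 2 ^ γ * (a ^ γ + c ^ γ) := by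
  have h1 : a + c ≤ 2 * max a c := by
    rw [two_mul]; exact add_le_add (le_max_left _ _) (le_max_right _ _)
  calc (a + c) ^ γ ≤ (2 * max a c) ^ γ := Real.rpow_le_rpow (by positivity) h1 hγ
    _ = 2 ^ γ * (max a c) ^ γ := Real.mul_rpow (by norm_num) (le_max_of_le_left ha)
    _ ≤ _ := by
        gcongr
        rcases le_total a c with h | h
        · rw [max_eq_right h]; have := Real.rpow_nonneg ha γ; linarith
        · rw [max_eq_left h]; have := Real.rpow_nonneg hc γ; linarith

/-! ### The Sobolev case -/

section SobolevExponent

variable {X : Type*} [MetricSpace X] {Λ : ℝ} {Q p ε : X → ℝ}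

theorem RegularExponents.sobolevExp_le (h : RegularExponents Λ Q p ε) {x : X}
    (hx : Λ⁻¹ ≤ Q x - ε x * p x) : sobolevExp Q p ε x ≤ Λ ^ 3 := by
  have hΛi : 0 < Λ⁻¹ := inv_pos.2 h.pos
  rw [sobolevExp, div_le_iff₀ (by linarith)]
  have h1 : Q x * p x ≤ Λ * Λ := mul_le_mul (h.Q_le x) (h.p_le x) (h.p_pos x).le h.pos.le
  have h2 : Λ ^ 3 * Λ⁻¹ ≤ Λ ^ 3 * (Q x - ε x * p x) :=
    mul_le_mul_of_nonneg_left hx (pow_pos h.pos 3).le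
  have h3 : Λ ^ 3 * Λ⁻¹ = Λ * Λ := by have := h.pos; field_simp
  linarith

theorem RegularExponents.le_sobolevExp (h : RegularExponents Λ Q p ε) {x : X}
    (hx : Λ⁻¹ ≤ Q x - ε x * p x) : Λ⁻¹ ≤ sobolevExp Q p ε x := by
  have hΛi : 0 < Λ⁻¹ := inv_pos.2 h.pos
  refine (h.le_p x).trans ?_
  rw [sobolevExp, le_div_iff₀ (by linarith)]
  nlinarith [mul_pos (h.ε_pos x) (mul_pos (h.p_pos x) (h.p_pos x))]

theorem holderExp_eq_neg_div {x : X} (hp : 0 < p x) :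
    holderExp Q p ε x = -((Q x - ε x * p x) / p x) := by
  rw [holderExp]; field_simp; ring

theorem RegularExponents.abs_holderExp_le (h : RegularExponents Λ Q p ε) (x : X) :
    |holderExp Q p ε x| ≤ Λ ^ 2 := by
  have h1 := h.Q_div_p_le x
  have h2 := h.Q_div_p_nonneg x
  have h3 := h.ε_pos x
  have h4 := h.ε_le x
  have h5 := h.one_le
  rw [abs_le, holderExp]
  constructor <;> nlinarith

end SobolevExponent

/-- With `α < 0` the sum is comparable to its last term. At radius `t = H ^ (-p / Q)` the terms `t ^
ε * H` and `t ^ α` coincide and equal `H ^ ((Q - ε * p) / Q)`. If `t` exceeds the initial radius, `n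
= 0` suffices and `R ^ α` dominates. -/
theorem exists_sobolev_pointwise (Λ δ A σ : ℝ) (hΛ : 1 ≤ Λ) (hA : 1 ≤ A) (hσ : 1 < σ) :
    ∃ C : ℝ, 1 ≤ C ∧ ∀ (X : Type w) [MetricSpace X] (Q p ε : X → ℝ) (x₀ : X) (r₀ : ℝ) (S : Set X)
      (U H : X → ℝ) (lam : ℝ), 0 < r₀ → r₀ ≤ δ / σ → (∀ x, Λ⁻¹ ≤ Q x - ε x * p x) →
      HajlaszData Λ δ A lam Q p ε (Metric.ball x₀ (σ * r₀)) S U H →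
      ∃ c : ℝ, ∀ x ∈ S ∩ Metric.ball x₀ r₀, |U x - c| ≤ lam * (C *
        (((σ - 1) * r₀) ^ holderExp Q p ε x + H x ^ ((Q x - ε x * p x) / Q x))) := by
  obtain ⟨C, hC, hchain⟩ := exists_common_chain_bound.{w} Λ δ A σ hΛ hA hσ
  set κ : ℝ := (Λ ^ 2)⁻¹ with hκ
  have hΛ0 : 0 < Λ := by linarith
  have hκ0 : 0 < κ := by positivity
  have hθ1 : (2 : ℝ) ^ (-κ) < 1 := Real.rpow_lt_one_of_one_lt_of_neg (by norm_num) (by linarith)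
  set D : ℝ := (1 - 2 ^ (-κ))⁻¹ with hD
  have hD0 : 0 < D := inv_pos.2 (by linarith)
  have hD' : 0 ≤ D * 2 ^ (Λ ^ 2) := by positivity
  refine ⟨C * (2 + D * 2 ^ (Λ ^ 2)), one_le_mul_of_one_le_of_one_le hC (by linarith), ?_⟩
  intro X _ Q p ε x₀ r₀ S U H lam hr₀ hr₀δ hgap h
  obtain ⟨c, hc⟩ := hchain X Q p ε x₀ r₀ S U H lam hr₀ hr₀δ h
  refine ⟨c, fun x hx => ?_⟩
  set R := (σ - 1) * r₀ with hR
  have hR0 : 0 < R := mul_pos (by linarith) hr₀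
  set α := holderExp Q p ε x with hα
  have hp := h.exps.p_pos x
  have hQ := h.exps.Q_pos x
  have hακ : α ≤ -κ := by
    rw [hα, holderExp_eq_neg_div hp, neg_le_neg_iff, hκ, pow_two, mul_inv, ← div_eq_mul_inv]
    exact div_le_div₀ ((inv_pos.2 hΛ0).le.trans (hgap x)) (hgap x) hp (h.exps.p_le x)
  have hαΛ : -α ≤ Λ ^ 2 := (neg_le_abs _).trans (h.exps.abs_holderExp_le x)
  have hH := h.H_nonneg x
  suffices hs : ∃ n : ℕ, (R / 2 ^ n) ^ ε x * H x + ∑ j ∈ Finset.range (n + 1), (R / 2 ^ j) ^ α ≤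
      (2 + D * 2 ^ (Λ ^ 2)) * (R ^ α + H x ^ ((Q x - ε x * p x) / Q x)) by
    obtain ⟨n, hn⟩ := hs
    refine (hc x hx n).trans (mul_le_mul_of_nonneg_left ?_ h.lam_nonneg)
    rw [mul_assoc]
    exact mul_le_mul_of_nonneg_left hn (by linarith)
  have hRα : 0 < R ^ α := by positivity
  have hHγ : 0 ≤ H x ^ ((Q x - ε x * p x) / Q x) := Real.rpow_nonneg hH _
  rcases le_or_gt (H x) (R ^ (-(Q x / p x))) with hle | hgt
  · refine ⟨0, ?_⟩
    have h1 : R ^ ε x * H x ≤ R ^ α := by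
      rw [hα, ← rpow_mul_rpow_eq_holderExp hR0]
      gcongr
    simp only [pow_zero, div_one, zero_add, Finset.range_one, Finset.sum_singleton]
    nlinarith [mul_nonneg hD' hRα.le, mul_nonneg hD' hHγ]
  · have hH0 : 0 < H x := lt_trans (by positivity) hgt
    set t := H x ^ (-(p x / Q x)) with ht
    have ht0 : 0 < t := by positivity
    have htH : t ^ (-(Q x / p x)) = H x := by
      rw [ht, ← Real.rpow_mul hH, show -(p x / Q x) * -(Q x / p x) = 1 by field_simp,
        Real.rpow_one]
    have htR : t ≤ R := by
      rw [← htH] at hgt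
      exact ((Real.rpow_lt_rpow_iff_of_neg hR0 ht0 (neg_neg_of_pos (div_pos hQ hp))).1 hgt).le
    have htα : t ^ α = H x ^ ((Q x - ε x * p x) / Q x) := by
      rw [ht, ← Real.rpow_mul hH, hα, holderExp_eq_neg_div hp]
      congr 1; field_simp
    obtain ⟨n, hn1, hn2⟩ := exists_dyadic_radius ht0 htR
    -- One step further than `n`, so that the radius lies between `t / 2` and `t`: the upper bound
    -- serves the `H` term, the lower bound the negative power `α`.
    refine ⟨n + 1, ?_⟩
    have hr : 0 < R / 2 ^ (n + 1) := by positivity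
    have h1 : (R / 2 ^ (n + 1)) ^ ε x * H x ≤ t ^ α := by
      calc (R / 2 ^ (n + 1)) ^ ε x * H x ≤ t ^ ε x * t ^ (-(Q x / p x)) := by
            rw [htH]
            exact mul_le_mul_of_nonneg_right
              (Real.rpow_le_rpow hr.le hn1 (h.exps.ε_pos x).le) hH
        _ = t ^ α := rpow_mul_rpow_eq_holderExp ht0 x
    have h2 : (R / 2 ^ (n + 1)) ^ α ≤ 2 ^ (Λ ^ 2) * t ^ α := by
      have h3 : t / 2 ≤ R / 2 ^ (n + 1) := by
        rw [pow_succ, ← div_div]; linarith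
      calc (R / 2 ^ (n + 1)) ^ α ≤ (t / 2) ^ α :=
            Real.rpow_le_rpow_of_nonpos (by positivity) h3 (by linarith)
        _ = 2 ^ (-α) * t ^ α := by
            rw [Real.div_rpow ht0.le (by norm_num), Real.rpow_neg (by norm_num)]; field_simp
        _ ≤ _ := by
            gcongr
            · norm_num
    have h4 := sum_dyadic_rpow_le_last hR0 hκ0 hακ (n + 1)
    have h5 : D * (R / 2 ^ (n + 1)) ^ α ≤ D * (2 ^ (Λ ^ 2) * t ^ α) := by gcongr
    rw [← htα]
    have : 0 < t ^ α := by positivity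
    nlinarith [mul_nonneg hD' hRα.le]

/-- On a ball, `((σ - 1) * r₀) ^ (± Q x)` is comparable with `r₀ ^ (± Q x₀)`. -/
theorem exists_radius_comparison (Λ δ σ : ℝ) (hΛ : 1 ≤ Λ) (hσ : 1 < σ) :
    ∃ C : ℝ, 1 ≤ C ∧ ∀ (X : Type w) [MetricSpace X] (Q p ε : X → ℝ),
      RegularExponents Λ Q p ε → ∀ (x₀ x : X) (r₀ : ℝ), 0 < r₀ → r₀ ≤ δ / σ → dist x x₀ < r₀ →
        ((σ - 1) * r₀) ^ Q x ≤ C * r₀ ^ Q x₀ ∧ ((σ - 1) * r₀) ^ (-Q x) ≤ C * r₀ ^ (-Q x₀) := by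
  have hσ1 : 0 < σ - 1 := by linarith
  have hK : 0 < 1 / (σ - 1) := one_div_pos.2 hσ1
  obtain ⟨C, hC, hcomp⟩ := exists_rpow_comparison.{w} Λ δ (1 + 1 / (σ - 1)) hΛ (by linarith)
  have h1 : 1 ≤ σ ^ Λ := Real.one_le_rpow hσ.le (by linarith)
  have h2 : 1 ≤ (1 + 1 / (σ - 1)) ^ Λ := Real.one_le_rpow (by linarith) (by linarith)
  have hC0 : 0 < C := by linarith
  refine ⟨C * (σ ^ Λ + (1 + 1 / (σ - 1)) ^ Λ),
    one_le_mul_of_one_le_of_one_le hC (by linarith), ?_⟩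
  intro X _ Q p ε h x₀ x r₀ hr₀ hr₀δ hx
  have hR0 : 0 < (σ - 1) * r₀ := mul_pos hσ1 hr₀
  have hRδ : (σ - 1) * r₀ ≤ δ := by
    rw [le_div_iff₀ (by linarith)] at hr₀δ
    linarith
  have hd : dist x x₀ ≤ (1 + 1 / (σ - 1)) * ((σ - 1) * r₀) := by
    have : (1 + 1 / (σ - 1)) * ((σ - 1) * r₀) = (σ - 1) * r₀ + r₀ := by field_simp
    linarith
  obtain ⟨-, hQ, hQ', -⟩ := hcomp X Q p ε h x x₀ _ hR0 hRδ hd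
  constructor
  · calc _ ≤ _ := hQ
      _ = C * (σ - 1) ^ Q x₀ * r₀ ^ Q x₀ := by rw [Real.mul_rpow hσ1.le hr₀.le, mul_assoc]
      _ ≤ _ := by
          gcongr
          have : (σ - 1) ^ Q x₀ ≤ σ ^ Λ :=
            (Real.rpow_le_rpow hσ1.le (by linarith) (h.Q_pos x₀).le).trans
              (Real.rpow_le_rpow_of_exponent_le hσ.le (h.Q_le x₀))
          linarith
  · calc _ ≤ _ := hQ'
      _ = C * (σ - 1) ^ (-Q x₀) * r₀ ^ (-Q x₀) := by rw [Real.mul_rpow hσ1.le hr₀.le, mul_assoc]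
      _ ≤ _ := by
          gcongr
          have : (σ - 1) ^ (-Q x₀) ≤ (1 + 1 / (σ - 1)) ^ Λ := by
            rw [Real.rpow_neg hσ1.le, ← Real.inv_rpow hσ1.le, ← one_div]
            exact (Real.rpow_le_rpow hK.le (by linarith) (h.Q_pos x₀).le).trans
              (Real.rpow_le_rpow_of_exponent_le (by linarith) (h.Q_le x₀))
          linarith

theorem luxNorm_le {X : Type*} [MetricSpace X] [MeasurableSpace X] {μ : Measure X} {E : Set X}
    {p : X → ℝ} {f : X → ℝ≥0∞} {l : ℝ} (hl : 0 < l)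
    (h : modular μ E p (fun x => f x / ENNReal.ofReal l) ≤ 1) :
    luxNorm μ E p f ≤ ENNReal.ofReal l :=
  iInf_le_of_le l (iInf_le_of_le hl (iInf_le_of_le h le_rfl))

/-- The Luxemburg norm of `f` is at most `a * V ^ (1 / γ⁻)` if the modular of `f / a` is at most
`V ≥ 1`. -/
theorem luxNorm_le_mul_rpow {X : Type*} [MetricSpace X] [MeasurableSpace X] {μ : Measure X}
    {E : Set X} {γ : X → ℝ} {f : X → ℝ} {a V γ₀ : ℝ} (ha : 0 < a) (hV : 1 ≤ V) (hγ₀ : 0 < γ₀)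
    (hγ : ∀ᵐ x ∂μ.restrict E, γ₀ ≤ γ x) (hf : ∀ x, 0 ≤ f x)
    (h : ∫⁻ x in E, ENNReal.ofReal ((f x / a) ^ γ x) ∂μ ≤ ENNReal.ofReal V) :
    luxNorm μ E γ (fun x => ENNReal.ofReal (f x)) ≤ ENNReal.ofReal (a * V ^ (1 / γ₀)) := by
  have hV0 : 0 < V := by linarith
  have hl : 0 < a * V ^ (1 / γ₀) := by positivity
  refine luxNorm_le hl ?_
  calc ∫⁻ x in E, (ENNReal.ofReal (f x) / ENNReal.ofReal (a * V ^ (1 / γ₀))) ^ γ x ∂μ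
      ≤ ∫⁻ x in E, ENNReal.ofReal V⁻¹ * ENNReal.ofReal ((f x / a) ^ γ x) ∂μ := by
        refine lintegral_mono_ae ?_
        filter_upwards [hγ] with x hx
        have hγx : 0 ≤ γ x := hγ₀.le.trans hx
        rw [← ENNReal.ofReal_div_of_pos hl, ENNReal.ofReal_rpow_of_nonneg
          (div_nonneg (hf x) hl.le) hγx, ← ENNReal.ofReal_mul (inv_nonneg.2 hV0.le)]
        refine ENNReal.ofReal_le_ofReal ?_
        rw [← div_div, Real.div_rpow (div_nonneg (hf x) ha.le) (by positivity), div_eq_mul_inv,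
          mul_comm]
        refine mul_le_mul_of_nonneg_right ?_ (Real.rpow_nonneg (div_nonneg (hf x) ha.le) _)
        refine inv_anti₀ hV0 ?_
        rw [← Real.rpow_mul hV0.le]
        refine Real.self_le_rpow_of_one_le hV ?_
        -- `V ≤ V ^ (γ x / γ₀)` because `V ≥ 1` and `γ x ≥ γ₀`; the lower exponent bound thus fixes
        -- the power of `V`.
        rw [one_div_mul_eq_div, one_le_div hγ₀]
        exact hx
    _ = ENNReal.ofReal V⁻¹ * ∫⁻ x in E, ENNReal.ofReal ((f x / a) ^ γ x) ∂μ :=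
        lintegral_const_mul' _ _ ENNReal.ofReal_ne_top
    _ ≤ ENNReal.ofReal V⁻¹ * ENNReal.ofReal V := by gcongr
    _ = 1 := by
        rw [← ENNReal.ofReal_mul (inv_nonneg.2 hV0.le), inv_mul_cancel₀ hV0.ne',
          ENNReal.ofReal_one]

theorem luxNorm_congr_ae {X : Type*} [MetricSpace X] [MeasurableSpace X] {μ : Measure X}
    {E : Set X} {p : X → ℝ} {f₁ f₂ : X → ℝ≥0∞} (h : ∀ᵐ x ∂μ.restrict E, f₁ x = f₂ x) :
    luxNorm μ E p f₁ = luxNorm μ E p f₂ := by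
  have : ∀ l : ℝ, modular μ E p (fun x => f₁ x / ENNReal.ofReal l) =
      modular μ E p (fun x => f₂ x / ENNReal.ofReal l) := fun l => by
    refine lintegral_congr_ae ?_
    filter_upwards [h] with x hx
    rw [hx]
  simp only [luxNorm, this]

theorem Setting.mul_rpow_le_measureReal {X : Type*} [MetricSpace X] [MeasurableSpace X]
    {μ : Measure X} {b δ Λ : ℝ} {Q p ε s : X → ℝ} (h : Setting b δ Λ μ Q p ε s) {x₀ : X} {r₀ : ℝ}
    (hr : 0 < r₀) (hrδ : r₀ ≤ δ) : b * r₀ ^ Q x₀ ≤ μ.real (Metric.ball x₀ r₀) :=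
  (ENNReal.ofReal_le_iff_le_toReal (h.metricMeasure x₀ r₀ hr).2.ne).1
    (h.lowerRegular x₀ r₀ hr hrδ)

theorem absSub_eq {X : Type*} {u : X → EReal} {x : X} (hx : u x = ((u x).toReal : EReal)) (c : ℝ) :
    absSub u c x = ENNReal.ofReal |(u x).toReal - c| := by
  rw [absSub, hx, abs_coe_sub_coe, EReal.toReal_coe]

/-- Raising the pointwise bound to the power `γ` turns its two terms into `R ^ (-Q)` and `H ^ p`,
since `α * γ = -Q` and `γ * (Q - ε * p) / Q = p`. The modular is then at most a multiple of `μ(B₀) /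
r₀ ^ Q x₀`, where `b ≤ μ(B₀) / r₀ ^ Q x₀` absorbs the constant `A`. -/
theorem sobolev_inequality (b δ σ Λ : ℝ) (hb : 0 < b) (hδ : 0 < δ) (hσ : 1 < σ) (hΛ : 0 < Λ) :
    ∃ C_S : ℝ, 0 < C_S ∧
      ∀ (X : Type w) [MetricSpace X] [MeasurableSpace X] [BorelSpace X] (μ : Measure X)
        (Q p ε s : X → ℝ), Setting b δ Λ μ Q p ε s →
        EssGap μ Λ⁻¹ (fun x => ε x * p x) Q →
        ∀ (x₀ : X) (r₀ : ℝ) (q : X → ℝ≥0∞) (u : X → EReal) (g : ℤ → X → ℝ≥0∞),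
          LocalData δ σ μ p s x₀ r₀ q u g →
          ⨅ c : ℝ, luxNorm μ (Metric.ball x₀ r₀) (sobolevExp Q p ε) (absSub u c) ≤
            ENNReal.ofReal (C_S * (μ.real (Metric.ball x₀ r₀) / r₀ ^ Q x₀) ^
              (1 / essInf (sobolevExp Q p ε) (μ.restrict (Metric.ball x₀ r₀)))) *
            mixedNorm μ (Metric.ball x₀ (σ * r₀)) p q g := by
  by_cases hΛ1 : 1 ≤ Λ
  swap
  · refine ⟨1, one_pos, fun X _ _ _ μ Q p ε s hset _ x₀ => ?_⟩
    exact absurd (hset.regularExponents hΛ x₀).one_le hΛ1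
  obtain ⟨A, hA, hmaj⟩ := exists_gradient_majorant.{w} b δ σ Λ hb hδ hσ hΛ
  obtain ⟨C, hC, hpt⟩ := exists_sobolev_pointwise.{w} Λ δ A σ hΛ1 hA hσ
  obtain ⟨K, hK, hrad⟩ := exists_radius_comparison.{w} Λ δ σ hΛ1 hσ
  have h2 : (0 : ℝ) < 2 ^ (Λ ^ 3) := by positivity
  -- The first summand bounds the modular by `C' * M`, `1 / b` gives `C' * M ≥ 1`, and the final `1`
  -- gives `C' ≥ 1`, so that `C' ^ (1 / γ₀) ≤ C' ^ Λ`.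
  set C' : ℝ := 2 ^ (Λ ^ 3) * (K + A / b) + 1 / b + 1 with hC'
  have hC'1 : 1 ≤ C' := by
    have : 0 ≤ 2 ^ (Λ ^ 3) * (K + A / b) + 1 / b := by positivity
    linarith
  refine ⟨2 * C * C' ^ Λ, by positivity, ?_⟩
  intro X _ _ _ μ Q p ε s hset hgap x₀ r₀ q u g hloc
  have hexp := hset.regularExponents hΛ x₀
  have hgap' : ∀ x, Λ⁻¹ ≤ Q x - ε x * p x :=
    forall_le_of_ae_le hset.metricMeasure continuous_const
      (hexp.continuous_Q.sub (hexp.continuous_ε.mul hexp.continuous_p)) hgap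
  have hr₀ := hloc.radius_pos
  have hr₀δ : r₀ ≤ δ := hloc.radius_le.trans (div_le_self hδ.le hσ.le)
  set B := Metric.ball x₀ r₀ with hB
  have hBm : MeasurableSet B := Metric.isOpen_ball.measurableSet
  have hBE : B ⊆ Metric.ball x₀ (σ * r₀) := Metric.ball_subset_ball (by nlinarith)
  have hBμ := hset.metricMeasure x₀ r₀ hr₀
  set γ := sobolevExp Q p ε with hγ
  set γ₀ := essInf γ (μ.restrict B) with hγ₀
  have hne : μ.restrict B ≠ 0 := by simpa using hBμ.1.ne'
  have : NeZero (μ.restrict B) := ⟨hne⟩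
  have hγlo : ∀ x, Λ⁻¹ ≤ γ x := fun x => hexp.le_sobolevExp (hgap' x)
  have hγhi : ∀ x, γ x ≤ Λ ^ 3 := fun x => hexp.sobolevExp_le (hgap' x)
  have hγ₀lo : Λ⁻¹ ≤ γ₀ :=
    le_essInf_of_ae_le _ (Filter.Eventually.of_forall hγlo)
      (Filter.IsBoundedUnder.isCoboundedUnder_ge
        ⟨Λ ^ 3, Filter.eventually_map.2 (Filter.Eventually.of_forall hγhi)⟩)
  have hγ₀le : ∀ᵐ x ∂μ.restrict B, γ₀ ≤ γ x :=
    ae_essInf_le ⟨Λ⁻¹, Filter.eventually_map.2 (Filter.Eventually.of_forall hγlo)⟩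
  have hγ₀0 : 0 < γ₀ := (inv_pos.2 hΛ).trans_le hγ₀lo
  have hrQ : 0 < r₀ ^ Q x₀ := by positivity
  set M := μ.real B / r₀ ^ Q x₀ with hM
  have hMb : b ≤ M := by
    rw [hM, le_div_iff₀ hrQ]; exact hset.mul_rpow_le_measureReal hr₀ hr₀δ
  have hM0 : 0 < M := by linarith
  refine le_mul_of_forall_lt_ofReal (by simpa using by positivity) ENNReal.ofReal_ne_top ?_
  intro lam hlam
  have hlam0 : 0 < lam := ENNReal.ofReal_pos.1 (bot_le.trans_lt hlam)
  obtain ⟨S, H, hdata, hS, hu, hHint⟩ := hmaj X μ Q p ε s hset x₀ r₀ q u g hloc lam hlam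
  obtain ⟨c, hc⟩ := hpt X Q p ε x₀ r₀ S _ H _ hr₀ hloc.radius_le hgap' hdata
  have hSB : ∀ᵐ x ∂μ.restrict B, x ∈ S ∩ B := by
    filter_upwards [ae_mono (Measure.restrict_mono hBE le_rfl) hS, ae_restrict_mem hBm]
      with x h1 h2 using ⟨h1, h2⟩
  refine iInf_le_of_le c ?_
  have hcongr : luxNorm μ B γ (absSub u c) =
      luxNorm μ B γ (fun x => ENNReal.ofReal |(u x).toReal - c|) := by
    refine luxNorm_congr_ae ?_
    filter_upwards [hSB] with x hx using absSub_eq (hu x hx.1) c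
  have hV : 1 ≤ C' * M := by
    calc (1 : ℝ) = 1 / b * b := by field_simp
      _ ≤ C' * M := by
          have : 0 ≤ 2 ^ (Λ ^ 3) * (K + A / b) := by positivity
          gcongr
          linarith
  have ha : 0 < 2 * lam * C := by positivity
  rw [hcongr]
  refine (luxNorm_le_mul_rpow (V := C' * M) ha hV hγ₀0 hγ₀le (fun x => abs_nonneg _) ?_).trans ?_
  · have hpw : ∀ x ∈ S ∩ B, (|(u x).toReal - c| / (2 * lam * C)) ^ γ x ≤
        2 ^ (Λ ^ 3) * (K * r₀ ^ (-Q x₀)) + 2 ^ (Λ ^ 3) * H x ^ p x := by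
      intro x hx
      have hp := hexp.p_pos x
      have hQ := hexp.Q_pos x
      have hg0 : 0 < Q x - ε x * p x := (inv_pos.2 hΛ).trans_le (hgap' x)
      have hR : 0 < (σ - 1) * r₀ := mul_pos (by linarith) hr₀
      have hγx : 0 ≤ γ x := (inv_pos.2 hΛ).le.trans (hγlo x)
      have h1 : |(u x).toReal - c| / (2 * lam * C) ≤
          ((σ - 1) * r₀) ^ holderExp Q p ε x + H x ^ ((Q x - ε x * p x) / Q x) := by
        rw [div_le_iff₀ ha]
        refine (hc x hx).trans (le_of_eq ?_)
        ring
      have hHx := hdata.H_nonneg x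
      calc _ ≤ _ := Real.rpow_le_rpow (by positivity) h1 hγx
        _ ≤ 2 ^ γ x * ((((σ - 1) * r₀) ^ holderExp Q p ε x) ^ γ x +
              (H x ^ ((Q x - ε x * p x) / Q x)) ^ γ x) :=
            add_rpow_le_two_rpow_mul (by positivity) (by positivity) hγx
        _ = 2 ^ γ x * (((σ - 1) * r₀) ^ (-Q x) + H x ^ p x) := by
            rw [← Real.rpow_mul hR.le, ← Real.rpow_mul hHx]
            congr 3
            · rw [holderExp_eq_neg_div hp, hγ, sobolevExp]; field_simp
            · rw [hγ, sobolevExp]; field_simp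
        _ ≤ 2 ^ (Λ ^ 3) * (K * r₀ ^ (-Q x₀) + H x ^ p x) := by
            have h3 := (hrad X Q p ε hexp x₀ x r₀ hr₀ hloc.radius_le hx.2).2
            have h4 : (2 : ℝ) ^ γ x ≤ 2 ^ (Λ ^ 3) :=
              Real.rpow_le_rpow_of_exponent_le (by norm_num) (hγhi x)
            have : 0 ≤ H x ^ p x := Real.rpow_nonneg hHx _
            gcongr
        _ = _ := by ring
    have hH0 : ∀ x, 0 ≤ H x ^ p x := fun x => Real.rpow_nonneg (hdata.H_nonneg x) _
    have hHB : ∫⁻ x in B, ENNReal.ofReal (H x ^ p x) ∂μ ≤ ENNReal.ofReal A :=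
      (lintegral_mono_set hBE).trans hHint
    calc ∫⁻ x in B, ENNReal.ofReal ((|(u x).toReal - c| / (2 * lam * C)) ^ γ x) ∂μ
        ≤ ∫⁻ x in B, (ENNReal.ofReal (2 ^ (Λ ^ 3) * (K * r₀ ^ (-Q x₀))) +
            ENNReal.ofReal (2 ^ (Λ ^ 3)) * ENNReal.ofReal (H x ^ p x)) ∂μ := by
          refine lintegral_mono_ae ?_
          filter_upwards [hSB] with x hx
          rw [← ENNReal.ofReal_mul h2.le, ← ENNReal.ofReal_add (by positivity)
            (mul_nonneg h2.le (hH0 x))]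
          exact ENNReal.ofReal_le_ofReal (hpw x hx)
      _ = ENNReal.ofReal (2 ^ (Λ ^ 3) * (K * r₀ ^ (-Q x₀))) * μ B +
            ENNReal.ofReal (2 ^ (Λ ^ 3)) * ∫⁻ x in B, ENNReal.ofReal (H x ^ p x) ∂μ := by
          rw [lintegral_add_left measurable_const, setLIntegral_const,
            lintegral_const_mul' _ _ ENNReal.ofReal_ne_top]
      _ ≤ ENNReal.ofReal (2 ^ (Λ ^ 3) * (K * r₀ ^ (-Q x₀))) * ENNReal.ofReal (μ.real B) +
            ENNReal.ofReal (2 ^ (Λ ^ 3)) * ENNReal.ofReal A := by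
          rw [ofReal_measureReal hBμ.2.ne]
          gcongr
      _ = ENNReal.ofReal (2 ^ (Λ ^ 3) * K * M + 2 ^ (Λ ^ 3) * A) := by
          rw [← ENNReal.ofReal_mul (by positivity), ← ENNReal.ofReal_mul h2.le,
            ← ENNReal.ofReal_add (by positivity) (by positivity), hM, Real.rpow_neg hr₀.le]
          congr 1; ring
      _ ≤ ENNReal.ofReal (C' * M) := by
          refine ENNReal.ofReal_le_ofReal ?_
          have h5 : A ≤ A / b * M := by
            calc A = A / b * b := by field_simp
              _ ≤ _ := by gcongr
          have h6 : 2 ^ (Λ ^ 3) * A ≤ 2 ^ (Λ ^ 3) * (A / b * M) := by gcongr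
          have h7 : 0 ≤ (1 / b + 1) * M := by positivity
          rw [hC']
          linarith
  · rw [← ENNReal.ofReal_mul (by positivity)]
    refine ENNReal.ofReal_le_ofReal ?_
    rw [Real.mul_rpow (by linarith) hM0.le]
    have h8 : C' ^ (1 / γ₀) ≤ C' ^ Λ := by
      refine Real.rpow_le_rpow_of_exponent_le hC'1 ?_
      rw [one_div]; exact inv_le_of_inv_le₀ hΛ hγ₀lo
    calc 2 * lam * C * (C' ^ (1 / γ₀) * M ^ (1 / γ₀))
        ≤ 2 * lam * C * (C' ^ Λ * M ^ (1 / γ₀)) := by gcongr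
      _ = _ := by ring

/-! ### The Moser-Trudinger case -/

/-- With `α = 0` each link contributes a constant, so `|U - c| / lam` is bounded by a multiple of
the number of steps down to radius `t = H ^ (-1 / ε)`. That number is about `log₂ (R / t)`, and `(R
/ t) ^ Q = R ^ Q * H ^ p`. -/
theorem exists_exponential_pointwise (Λ δ A σ : ℝ) (hΛ : 1 ≤ Λ) (hA : 1 ≤ A) (hσ : 1 < σ) :
    ∃ C c₀ : ℝ, 1 ≤ C ∧ 0 < c₀ ∧ ∀ (X : Type w) [MetricSpace X] (Q p ε : X → ℝ) (x₀ : X) (r₀ : ℝ)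
      (S : Set X) (U H : X → ℝ) (lam : ℝ), 0 < r₀ → r₀ ≤ δ / σ → (∀ x, ε x * p x = Q x) →
      0 < lam → HajlaszData Λ δ A lam Q p ε (Metric.ball x₀ (σ * r₀)) S U H →
      ∃ c : ℝ, ∀ x ∈ S ∩ Metric.ball x₀ r₀, Real.exp (c₀ / lam * |U x - c|) ≤
        C * (1 + ((σ - 1) * r₀) ^ Q x * H x ^ p x) := by
  obtain ⟨C, hC, hchain⟩ := exists_common_chain_bound.{w} Λ δ A σ hΛ hA hσ
  have hΛ0 : 0 < Λ := by linarith
  have hlog2 : 0 < Real.log 2 := Real.log_pos (by norm_num)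
  -- Chosen so that `β ≤ Q * log 2`; hence `exp (β * n) ≤ (2 ^ n) ^ Q`. The factor `exp (3 * β)`
  -- below collects the extra summands: `n + 2` links and at most `1` from the `H` term.
  set β : ℝ := Real.log 2 / Λ with hβ
  have hβ0 : 0 < β := by positivity
  have hC0 : 0 < C := by linarith
  refine ⟨Real.exp (3 * β), β / C, Real.one_le_exp (by positivity), by positivity, ?_⟩
  intro X _ Q p ε x₀ r₀ S U H lam hr₀ hr₀δ hQε hlam h
  obtain ⟨c, hc⟩ := hchain X Q p ε x₀ r₀ S U H lam hr₀ hr₀δ h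
  refine ⟨c, fun x hx => ?_⟩
  set R := (σ - 1) * r₀ with hR
  have hR0 : 0 < R := mul_pos (by linarith) hr₀
  have hp := h.exps.p_pos x
  have hQ := h.exps.Q_pos x
  have hε := h.exps.ε_pos x
  have hH := h.H_nonneg x
  have hα : holderExp Q p ε x = 0 := by
    rw [holderExp, ← hQε]; field_simp; ring
  have hbd : ∀ n : ℕ, β / C / lam * |U x - c| ≤ β * ((R / 2 ^ n) ^ ε x * H x + (n + 1)) := by
    intro n
    have h1 := hc x hx n
    simp only [hα, Real.rpow_zero, Finset.sum_const, Finset.card_range, nsmul_eq_mul,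
      mul_one] at h1
    push_cast at h1
    calc β / C / lam * |U x - c|
        ≤ β / C / lam * (lam * (C * ((R / 2 ^ n) ^ ε x * H x + (n + 1)))) := by gcongr
      _ = _ := by field_simp
  have hlast : 0 ≤ R ^ Q x * H x ^ p x := mul_nonneg (by positivity) (Real.rpow_nonneg hH _)
  rcases le_or_gt (H x) (R ^ (-ε x)) with hle | hgt
  · have h1 : R ^ ε x * H x ≤ 1 := by
      calc R ^ ε x * H x ≤ R ^ ε x * R ^ (-ε x) := by gcongr
        _ = 1 := by rw [← Real.rpow_add hR0, add_neg_cancel, Real.rpow_zero]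
    have h2 := hbd 0
    simp only [pow_zero, div_one, Nat.cast_zero, zero_add] at h2
    have h3 : β / C / lam * |U x - c| ≤ 3 * β := by nlinarith
    calc _ ≤ Real.exp (3 * β) := Real.exp_le_exp.2 h3
      _ ≤ _ := le_mul_of_one_le_right (Real.exp_pos _).le (by linarith)
  · have hH0 : 0 < H x := lt_trans (by positivity) hgt
    set t := H x ^ (-(1 / ε x)) with ht
    have ht0 : 0 < t := by positivity
    have htH : t ^ (-ε x) = H x := by
      rw [ht, ← Real.rpow_mul hH, show -(1 / ε x) * -ε x = 1 by field_simp, Real.rpow_one]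
    have htR : t ≤ R := by
      rw [← htH] at hgt
      exact ((Real.rpow_lt_rpow_iff_of_neg hR0 ht0 (neg_neg_of_pos hε)).1 hgt).le
    obtain ⟨n, hn1, hn2⟩ := exists_dyadic_radius ht0 htR
    have hr : 0 < R / 2 ^ (n + 1) := by positivity
    have h1 : (R / 2 ^ (n + 1)) ^ ε x * H x ≤ 1 := by
      calc (R / 2 ^ (n + 1)) ^ ε x * H x ≤ t ^ ε x * t ^ (-ε x) := by
            rw [htH]
            exact mul_le_mul_of_nonneg_right (Real.rpow_le_rpow hr.le hn1 hε.le) hH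
        _ = 1 := by rw [← Real.rpow_add ht0, add_neg_cancel, Real.rpow_zero]
    have h2 := hbd (n + 1)
    push_cast at h2
    have h3 : β / C / lam * |U x - c| ≤ 3 * β + Real.log 2 * n * Q x := by
      have h4 : β ≤ Real.log 2 * Q x := by
        rw [hβ, div_eq_mul_inv]
        exact mul_le_mul_of_nonneg_left (h.exps.le_Q x) hlog2.le
      have h5 : β * n ≤ Real.log 2 * Q x * n := by gcongr
      have h6 : β * ((R / 2 ^ (n + 1)) ^ ε x * H x) ≤ β * 1 := by gcongr
      linarith
    have h7 : (2 : ℝ) ^ n ≤ R / t := by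
      rw [le_div_iff₀ ht0]
      rw [le_div_iff₀ (by positivity)] at hn2
      linarith
    have h8 : Real.exp (Real.log 2 * n * Q x) ≤ R ^ Q x * H x ^ p x := by
      calc Real.exp (Real.log 2 * n * Q x) = ((2 : ℝ) ^ n) ^ Q x := by
            rw [← Real.rpow_natCast, ← Real.rpow_mul (by norm_num),
              Real.rpow_def_of_pos (by norm_num), mul_assoc]
        _ ≤ (R / t) ^ Q x := Real.rpow_le_rpow (by positivity) h7 hQ.le
        _ = R ^ Q x * H x ^ p x := by
            rw [Real.div_rpow hR0.le ht0.le, ht, ← Real.rpow_mul hH, div_eq_mul_inv,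
              ← Real.rpow_neg hH]
            congr 2
            rw [← hQε x]; field_simp
    calc _ ≤ Real.exp (3 * β + Real.log 2 * n * Q x) := Real.exp_le_exp.2 h3
      _ = Real.exp (3 * β) * Real.exp (Real.log 2 * n * Q x) := Real.exp_add _ _
      _ ≤ _ := by gcongr; linarith

/-- Exponential integrability around a constant yields exponential integrability around the
mean. -/
theorem exponential_integrability_mean {X : Type*} [MeasurableSpace X] {μ : Measure X} {B : Set X}
    (hB0 : μ B ≠ 0) (hB : μ B ≠ ∞) {U : X → ℝ} (hU : AEMeasurable U (μ.restrict B))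
    {a c K : ℝ} (ha : 0 < a) (hK : 0 ≤ K)
    (h : ∫⁻ x in B, ENNReal.ofReal (Real.exp (a * |U x - c|)) ∂μ ≤ ENNReal.ofReal K * μ B) :
    IntegrableOn U B μ ∧ ⨍⁻ x in B, ENNReal.ofReal (Real.exp (a * |U x - ⨍ y in B, U y ∂μ|)) ∂μ ≤
      ENNReal.ofReal (Real.exp K * K) := by
  have hBm : μ B = ENNReal.ofReal (μ.real B) := (ofReal_measureReal hB).symm
  have hBpos : 0 < μ.real B := ENNReal.toReal_pos hB0 hB
  have : IsFiniteMeasure (μ.restrict B) :=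
    ⟨by rw [Measure.restrict_apply_univ]; exact hB.lt_top⟩
  have hlin : ∫⁻ x in B, ENNReal.ofReal |U x - c| ∂μ ≤ ENNReal.ofReal (K / a * μ.real B) := by
    calc ∫⁻ x in B, ENNReal.ofReal |U x - c| ∂μ
        ≤ ∫⁻ x in B, ENNReal.ofReal a⁻¹ * ENNReal.ofReal (Real.exp (a * |U x - c|)) ∂μ := by
          refine lintegral_mono fun x => ?_
          rw [← ENNReal.ofReal_mul (inv_nonneg.2 ha.le)]
          refine ENNReal.ofReal_le_ofReal ?_
          rw [inv_mul_eq_div, le_div_iff₀ ha]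
          have := Real.add_one_le_exp (a * |U x - c|)
          linarith
      _ = ENNReal.ofReal a⁻¹ * ∫⁻ x in B, ENNReal.ofReal (Real.exp (a * |U x - c|)) ∂μ :=
          lintegral_const_mul' _ _ ENNReal.ofReal_ne_top
      _ ≤ ENNReal.ofReal a⁻¹ * (ENNReal.ofReal K * ENNReal.ofReal (μ.real B)) := by
          rw [← hBm]; gcongr
      _ = _ := by
          rw [← ENNReal.ofReal_mul hK, ← ENNReal.ofReal_mul (inv_nonneg.2 ha.le)]
          congr 1; field_simp
  have hint : Integrable (fun x => U x - c) (μ.restrict B) := by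
    refine ⟨(hU.sub_const c).aestronglyMeasurable, ?_⟩
    rw [hasFiniteIntegral_iff_norm]
    exact hlin.trans_lt ENNReal.ofReal_lt_top
  have hUint : Integrable U (μ.restrict B) := by
    exact (hint.add (integrable_const c)).congr (Filter.Eventually.of_forall fun x => by simp)
  refine ⟨hUint, ?_⟩
  set m := ⨍ y in B, U y ∂μ with hm
  -- From `a * |U - c| ≤ exp (a * |U - c|)`, averaged over `B`. Moving the centre from `c` to the
  -- mean therefore costs at most the factor `exp K`.
  have hmc : |m - c| ≤ K / a := by
    have h1 : m - c = (μ.real B)⁻¹ * ∫ x in B, (U x - c) ∂μ := by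
      rw [hm, setAverage_eq, integral_sub hUint (integrable_const c), integral_const, smul_eq_mul,
        smul_eq_mul, measureReal_restrict_apply_univ]
      field_simp
    have h2 : |∫ x in B, (U x - c) ∂μ| ≤ K / a * μ.real B := by
      refine (abs_integral_le_integral_abs).trans ?_
      rw [integral_eq_lintegral_of_nonneg_ae (Filter.Eventually.of_forall fun x => abs_nonneg _)
        hint.abs.aestronglyMeasurable]
      exact ENNReal.toReal_le_of_le_ofReal (by positivity) hlin
    rw [h1, abs_mul, abs_inv, abs_of_pos hBpos, inv_mul_le_iff₀ hBpos, mul_comm (μ.real B)]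
    exact h2
  rw [setLAverage_eq]
  refine ENNReal.div_le_of_le_mul ?_
  calc ∫⁻ x in B, ENNReal.ofReal (Real.exp (a * |U x - m|)) ∂μ
      ≤ ∫⁻ x in B, ENNReal.ofReal (Real.exp K) *
          ENNReal.ofReal (Real.exp (a * |U x - c|)) ∂μ := by
        refine lintegral_mono fun x => ?_
        rw [← ENNReal.ofReal_mul (Real.exp_pos _).le, ← Real.exp_add]
        refine ENNReal.ofReal_le_ofReal (Real.exp_le_exp.2 ?_)
        have h3 := abs_sub_le (U x) c m
        rw [abs_sub_comm c m] at h3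
        have h4 : a * |m - c| ≤ K := by
          rw [le_div_iff₀ ha] at hmc; linarith
        nlinarith
    _ = ENNReal.ofReal (Real.exp K) * ∫⁻ x in B, ENNReal.ofReal (Real.exp (a * |U x - c|)) ∂μ :=
        lintegral_const_mul' _ _ ENNReal.ofReal_ne_top
    _ ≤ ENNReal.ofReal (Real.exp K) * (ENNReal.ofReal K * μ B) := by gcongr
    _ = _ := by rw [ENNReal.ofReal_mul (Real.exp_pos _).le, mul_assoc]

theorem moser_trudinger_inequality (b δ σ Λ : ℝ) (hb : 0 < b) (hδ : 0 < δ) (hσ : 1 < σ)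
    (hΛ : 0 < Λ) :
    ∃ C_MT1 C_MT2 : ℝ, 0 < C_MT1 ∧ 0 < C_MT2 ∧
      ∀ (X : Type w) [MetricSpace X] [MeasurableSpace X] [BorelSpace X] (μ : Measure X)
        (Q p ε s : X → ℝ), Setting b δ Λ μ Q p ε s →
        (∀ x, ε x * p x = Q x) →
        ∀ (x₀ : X) (r₀ : ℝ) (q : X → ℝ≥0∞) (u : X → EReal) (g : ℤ → X → ℝ≥0∞),
          LocalData δ σ μ p s x₀ r₀ q u g →
          0 < mixedNorm μ (Metric.ball x₀ (σ * r₀)) p q g →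
          IntegrableOn (fun x => (u x).toReal) (Metric.ball x₀ r₀) μ ∧
          ⨍⁻ x in Metric.ball x₀ r₀, ENNReal.ofReal (Real.exp
            (C_MT1 * (|(u x).toReal - avg μ (Metric.ball x₀ r₀) u| /
              (mixedNorm μ (Metric.ball x₀ (σ * r₀)) p q g).toReal))) ∂μ ≤
            ENNReal.ofReal C_MT2 := by
  by_cases hΛ1 : 1 ≤ Λ
  swap
  · refine ⟨1, 1, one_pos, one_pos, fun X _ _ _ μ Q p ε s hset _ x₀ => ?_⟩
    exact absurd (hset.regularExponents hΛ x₀).one_le hΛ1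
  obtain ⟨A, hA, hmaj⟩ := exists_gradient_majorant.{w} b δ σ Λ hb hδ hσ hΛ
  obtain ⟨C, c₀, hC, hc₀, hpt⟩ := exists_exponential_pointwise.{w} Λ δ A σ hΛ1 hA hσ
  obtain ⟨K, hK, hrad⟩ := exists_radius_comparison.{w} Λ δ σ hΛ1 hσ
  set K₁ : ℝ := C * (1 + K * A / b) with hK₁
  have hK₁0 : 0 < K₁ := by positivity
  -- The quasi-norm `n` is positive and finite, so `lam = 2 * n` is allowed; the gradient `2 * lam *
  -- H` then makes the exponential constant `c₀ / (4 * n)`.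
  refine ⟨c₀ / 4, Real.exp K₁ * K₁, by positivity, by positivity, ?_⟩
  intro X _ _ _ μ Q p ε s hset hQε x₀ r₀ q u g hloc hpos
  have hexp := hset.regularExponents hΛ x₀
  have hfin := hloc.g_mem.mixedNorm_lt_top hΛ hexp.le_p hloc.q_mem
  set n := (mixedNorm μ (Metric.ball x₀ (σ * r₀)) p q g).toReal with hn
  have hn0 : 0 < n := ENNReal.toReal_pos hpos.ne' hfin.ne
  have hlam : mixedNorm μ (Metric.ball x₀ (σ * r₀)) p q g < ENNReal.ofReal (2 * n) := by
    rw [← ENNReal.ofReal_toReal hfin.ne, ← hn]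
    exact (ENNReal.ofReal_lt_ofReal_iff (by linarith)).2 (by linarith)
  have hr₀ := hloc.radius_pos
  have hr₀δ : r₀ ≤ δ := hloc.radius_le.trans (div_le_self hδ.le hσ.le)
  set B := Metric.ball x₀ r₀ with hB
  have hBm : MeasurableSet B := Metric.isOpen_ball.measurableSet
  have hBE : B ⊆ Metric.ball x₀ (σ * r₀) := Metric.ball_subset_ball (by nlinarith)
  have hBμ : 0 < μ B ∧ μ B < ∞ := hset.metricMeasure x₀ r₀ hr₀
  obtain ⟨S, H, hdata, hS, hu, hHint⟩ := hmaj X μ Q p ε s hset x₀ r₀ q u g hloc _ hlam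
  obtain ⟨c, hc⟩ := hpt X Q p ε x₀ r₀ S _ H _ hr₀ hloc.radius_le hQε (by linarith) hdata
  have hSB : ∀ᵐ x ∂μ.restrict B, x ∈ S ∩ B := by
    filter_upwards [ae_mono (Measure.restrict_mono hBE le_rfl) hS, ae_restrict_mem hBm]
      with x h1 h2 using ⟨h1, h2⟩
  have hU : AEMeasurable (fun x => (u x).toReal) (μ.restrict B) :=
    ((aemeasurable_restrict_of_measurable_subtype Metric.isOpen_ball.measurableSet
      hloc.u_mem.measurable).mono_measure (Measure.restrict_mono hBE le_rfl)).ereal_toReal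
  have hH0 : ∀ x, 0 ≤ H x ^ p x := fun x => Real.rpow_nonneg (hdata.H_nonneg x) _
  have hexpint : ∫⁻ x in B, ENNReal.ofReal (Real.exp (c₀ / (2 * (2 * n)) * |(u x).toReal - c|)) ∂μ ≤
      ENNReal.ofReal K₁ * μ B := by
    have hHB : ∫⁻ x in B, ENNReal.ofReal (H x ^ p x) ∂μ ≤ ENNReal.ofReal A :=
      (lintegral_mono_set hBE).trans hHint
    have hrQ : 0 < r₀ ^ Q x₀ := by positivity
    calc _ ≤ ∫⁻ x in B, (ENNReal.ofReal C +
            ENNReal.ofReal (C * (K * r₀ ^ Q x₀)) * ENNReal.ofReal (H x ^ p x)) ∂μ := by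
          refine lintegral_mono_ae ?_
          filter_upwards [hSB] with x hx
          have h1 : 0 ≤ C * (K * r₀ ^ Q x₀) := by positivity
          rw [← ENNReal.ofReal_mul h1, ← ENNReal.ofReal_add (by linarith) (mul_nonneg h1 (hH0 x))]
          refine ENNReal.ofReal_le_ofReal ((hc x hx).trans ?_)
          have h2 := (hrad X Q p ε hexp x₀ x r₀ hr₀ hloc.radius_le hx.2).1
          have h3 := hH0 x
          calc C * (1 + ((σ - 1) * r₀) ^ Q x * H x ^ p x)
              ≤ C * (1 + (K * r₀ ^ Q x₀) * H x ^ p x) := by gcongr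
            _ = _ := by ring
      _ = ENNReal.ofReal C * μ B +
            ENNReal.ofReal (C * (K * r₀ ^ Q x₀)) * ∫⁻ x in B, ENNReal.ofReal (H x ^ p x) ∂μ := by
          rw [lintegral_add_left measurable_const, setLIntegral_const,
            lintegral_const_mul' _ _ ENNReal.ofReal_ne_top]
      _ ≤ ENNReal.ofReal C * ENNReal.ofReal (μ.real B) +
            ENNReal.ofReal (C * (K * r₀ ^ Q x₀)) * ENNReal.ofReal A := by
          rw [ofReal_measureReal hBμ.2.ne]
          gcongr
      _ = ENNReal.ofReal (C * μ.real B + C * (K * r₀ ^ Q x₀) * A) := by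
          rw [← ENNReal.ofReal_mul (by linarith), ← ENNReal.ofReal_mul (by positivity),
            ← ENNReal.ofReal_add (by positivity) (by positivity)]
      _ ≤ ENNReal.ofReal (K₁ * μ.real B) := by
          refine ENNReal.ofReal_le_ofReal ?_
          have h4 := hset.mul_rpow_le_measureReal (x₀ := x₀) hr₀ hr₀δ
          have h5 : C * (K * r₀ ^ Q x₀) * A ≤ C * (K * A / b) * μ.real B := by
            calc C * (K * r₀ ^ Q x₀) * A = C * (K * A / b) * (b * r₀ ^ Q x₀) := by field_simp
              _ ≤ _ := by gcongr
          rw [hK₁]; linarith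
      _ = _ := by rw [ENNReal.ofReal_mul hK₁0.le, ofReal_measureReal hBμ.2.ne]
  obtain ⟨hint, hav⟩ := exponential_integrability_mean hBμ.1.ne' hBμ.2.ne hU
    (by positivity : 0 < c₀ / (2 * (2 * n))) hK₁0.le hexpint
  refine ⟨hint, le_trans (le_of_eq ?_) hav⟩
  have e : ∀ v : ℝ, c₀ / 4 * (v / n) = c₀ / (2 * (2 * n)) * v := fun v => by field_simp; ring
  simp only [e, avg]

/-! ### The Morrey case -/

/-- With `α > 0` the sum is bounded by its first term uniformly in `n`, and `n → ∞` removes `H x`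
because it is finite. Chains from `x` and `y` with radius `R ≈ dist x y` end in good points that are
joined by one more link. -/
theorem exists_holder_pointwise (Λ δ A σ : ℝ) (hΛ : 1 ≤ Λ) (hA : 1 ≤ A) (hσ : 1 < σ) :
    ∃ C : ℝ, 1 ≤ C ∧ ∀ (X : Type w) [MetricSpace X] (Q p ε : X → ℝ) (x₀ : X) (r₀ : ℝ) (S : Set X)
      (U H : X → ℝ) (lam : ℝ), 0 < r₀ → r₀ ≤ δ / σ → (∀ x, (Λ ^ 2)⁻¹ ≤ holderExp Q p ε x) →
      HajlaszData Λ δ A lam Q p ε (Metric.ball x₀ (σ * r₀)) S U H →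
      ∀ x ∈ S ∩ Metric.ball x₀ r₀, ∀ y ∈ S ∩ Metric.ball x₀ r₀,
        |U x - U y| ≤ lam * (C * dist x y ^ holderExp Q p ε x) := by
  obtain ⟨C, G, hC, hG, hchain⟩ := exists_chain_bound.{w} Λ δ A hΛ hA
  have hσ1 : 0 < σ - 1 := by linarith
  -- Since `dist x y < 2 * r₀`, the radius `R = m * dist x y` is at most `(σ - 1) * r₀`, so the
  -- balls around `x` and `y` stay in `σB₀`; `m ≤ 1` gives `R ≤ dist x y`.
  set m : ℝ := min 1 ((σ - 1) / 2) with hm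
  have hm0 : 0 < m := lt_min one_pos (by linarith)
  have hm1 : m ≤ 1 := min_le_left _ _
  have hm2 : m ≤ (σ - 1) / 2 := min_le_right _ _
  have hK : 1 ≤ 1 / m := (one_le_div hm0).2 hm1
  obtain ⟨C', hC', htwo⟩ := exists_two_point_bound.{w} Λ δ (1 / m) G hΛ hK hG
  obtain ⟨C'', hC'', hcomp⟩ := exists_rpow_comparison.{w} Λ δ (1 / m) hΛ hK
  have hΛ0 : 0 < Λ := by linarith
  set κ : ℝ := (Λ ^ 2)⁻¹ with hκ
  have hκ0 : 0 < κ := by positivity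
  have hθ1 : (2 : ℝ) ^ (-κ) < 1 := Real.rpow_lt_one_of_one_lt_of_neg (by norm_num) (by linarith)
  set D : ℝ := (1 - 2 ^ (-κ))⁻¹ with hD
  have hD0 : 0 < D := inv_pos.2 (by linarith)
  have hCD : 0 ≤ C * D + C * D * C'' := by positivity
  refine ⟨C * D + C * D * C'' + C', by linarith, ?_⟩
  intro X _ Q p ε x₀ r₀ S U H lam hr₀ hr₀δ hα h x hx y hy
  rcases eq_or_ne x y with rfl | hne
  · rw [sub_self, abs_zero]
    have := h.lam_nonneg
    have := Real.rpow_nonneg (dist_nonneg (x := x) (y := x)) (holderExp Q p ε x)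
    positivity
  have hd : 0 < dist x y := dist_pos.2 hne
  have hxd : dist x x₀ < r₀ := hx.2
  have hyd : dist y x₀ < r₀ := hy.2
  have hd2 : dist x y < 2 * r₀ := by
    have := dist_triangle_right x y x₀
    linarith
  set R := m * dist x y with hR
  have hR0 : 0 < R := mul_pos hm0 hd
  have hRd : R ≤ dist x y := mul_le_of_le_one_left hd.le hm1
  have hRr : R ≤ (σ - 1) * r₀ := by
    calc R ≤ (σ - 1) / 2 * (2 * r₀) := mul_le_mul hm2 hd2.le hd.le (by linarith)
      _ = _ := by ring
  have hRδ : R ≤ δ := by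
    rw [le_div_iff₀ (by linarith)] at hr₀δ
    linarith
  have hdR : dist x y = 1 / m * R := by rw [hR]; field_simp
  have hpoint : ∀ v ∈ S, dist v x₀ < r₀ → ∃ z ∈ S, dist z v < R ∧ H z ≤ G * R ^ (-(Q v / p v)) ∧
      |U v - U z| ≤ lam * (C * D * R ^ holderExp Q p ε v) := by
    intro v hvS hv
    obtain ⟨z, hzS, hzd, hzH, hz⟩ := hchain X Q p ε _ S U H lam h v hvS R hR0 hRδ
      (Metric.ball_subset_ball' (by linarith))
    refine ⟨z, hzS, hzd, hzH, ?_⟩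
    have hlim : Filter.Tendsto (fun n : ℕ => lam * (C * ((R / 2 ^ n) ^ ε v * H v +
        D * R ^ holderExp Q p ε v))) Filter.atTop
        (nhds (lam * (C * (0 * H v + D * R ^ holderExp Q p ε v)))) := by
      refine Filter.Tendsto.const_mul _ (Filter.Tendsto.const_mul _ (Filter.Tendsto.add_const _
        (Filter.Tendsto.mul_const _ ?_)))
      have h1 : Filter.Tendsto (fun n : ℕ => R / 2 ^ n) Filter.atTop (nhds 0) :=
        Filter.Tendsto.const_div_atTop (tendsto_pow_atTop_atTop_of_one_lt one_lt_two) R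
      have h2 := h1.rpow_const (p := ε v) (Or.inr (h.exps.ε_pos v).le)
      rwa [Real.zero_rpow (h.exps.ε_pos v).ne'] at h2
    have := ge_of_tendsto' hlim fun n => (hz n).trans (by
      have := sum_dyadic_rpow_le_first hR0 hκ0 (hα v) (n + 1)
      have := h.lam_nonneg
      gcongr)
    rw [zero_mul, zero_add, ← mul_assoc C] at this
    exact this
  obtain ⟨z, hzS, hzd, hzH, hz⟩ := hpoint x hx.1 hxd
  obtain ⟨v, hvS, hvd, hvH, hv⟩ := hpoint y hy.1 hyd
  have h1 : |U z - U v| ≤ lam * (C' * R ^ holderExp Q p ε x) :=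
    (h.ineq z hzS v hvS).trans (mul_le_mul_of_nonneg_left
      (htwo X Q p ε h.exps x y z v R _ _ hR0 hRδ hdR.le hzd.le hvd.le hzH hvH) h.lam_nonneg)
  have h2 := (hcomp X Q p ε h.exps y x R hR0 hRδ (by rw [dist_comm]; exact hdR.le)).2.2.2.2.2
  have hlam := h.lam_nonneg
  have h3 : |U y - U v| ≤ lam * (C * D * (C'' * R ^ holderExp Q p ε x)) := hv.trans (by gcongr)
  have h4 : R ^ holderExp Q p ε x ≤ dist x y ^ holderExp Q p ε x :=
    Real.rpow_le_rpow hR0.le hRd (hκ0.le.trans (hα x))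
  have h5 := abs_sub_le (U x) (U z) (U y)
  have h6 := abs_sub_le (U z) (U v) (U y)
  rw [abs_sub_comm (U v)] at h6
  calc |U x - U y| ≤ lam * ((C * D + C * D * C'' + C') * R ^ holderExp Q p ε x) := by linarith
    _ ≤ _ := by gcongr

/-- A function with a variable Hölder bound on a dense subset extends with the same bound. -/
theorem exists_holder_extension {X : Type*} [MetricSpace X] {B S : Set X} (hSB : B ⊆ closure S)
    {α U : X → ℝ} {κ L : ℝ} (hα : Continuous α) (hκ : 0 < κ) (hκα : ∀ x, κ ≤ α x) (hL : 0 ≤ L)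
    (hU : ∀ x ∈ S, ∀ y ∈ S, |U x - U y| ≤ L * dist x y ^ α x) :
    ∃ v : X → ℝ, ContinuousOn v B ∧ (∀ x ∈ S ∩ B, v x = U x) ∧
      ∀ x ∈ B, ∀ y ∈ B, |v x - v y| ≤ L * dist x y ^ α x := by
  -- At distances up to `1` the variable exponent may be lowered to the constant `κ`, which suffices
  -- for the Cauchy property and for continuity.
  have hlocal : ∀ x ∈ S, ∀ y ∈ S, dist x y ≤ 1 → |U x - U y| ≤ L * dist x y ^ κ := by
    intro x hx y hy hd
    rcases eq_or_ne x y with rfl | hne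
    · rw [sub_self, abs_zero]
      exact mul_nonneg hL (Real.rpow_nonneg dist_nonneg _)
    · exact (hU x hx y hy).trans (mul_le_mul_of_nonneg_left
        (Real.rpow_le_rpow_of_exponent_ge (dist_pos.2 hne) hd (hκα x)) hL)
  have hlim : ∀ x ∈ B, ∃ y, Filter.Tendsto U (nhdsWithin x S) (nhds y) := by
    intro x hx
    have : (nhdsWithin x S).NeBot := mem_closure_iff_nhdsWithin_neBot.1 (hSB hx)
    refine cauchy_map_iff_exists_tendsto.1 ?_
    rw [Metric.cauchy_iff]
    refine ⟨Filter.map_neBot, fun η hη => ?_⟩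
    have ht : Filter.Tendsto (fun r : ℝ => L * (2 * r) ^ κ) (nhdsWithin 0 (Set.Ioi 0))
        (nhds (L * (2 * 0) ^ κ)) := by
      have hc : Continuous fun r : ℝ => L * (2 * r) ^ κ :=
        continuous_const.mul ((continuous_const.mul continuous_id).rpow_const
          fun _ => Or.inr hκ.le)
      exact (hc.tendsto 0).mono_left nhdsWithin_le_nhds
    rw [mul_zero, Real.zero_rpow hκ.ne', mul_zero] at ht
    obtain ⟨r, hr1, hr0, hr2⟩ := ((ht.eventually (gt_mem_nhds hη)).and
      (Ioo_mem_nhdsGT (show (0 : ℝ) < 1 / 2 by norm_num))).exists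
    refine ⟨U '' (Metric.ball x r ∩ S), Filter.image_mem_map
      (Filter.inter_mem (mem_nhdsWithin_of_mem_nhds (Metric.ball_mem_nhds x hr0))
        self_mem_nhdsWithin), ?_⟩
    rintro _ ⟨a, ⟨hax, haS⟩, rfl⟩ _ ⟨c, ⟨hcx, hcS⟩, rfl⟩
    have hac : dist a c ≤ 2 * r := by
      have := dist_triangle_right a c x
      have h1 : dist a x < r := hax
      have h2 : dist c x < r := hcx
      linarith
    rw [Real.dist_eq]
    calc |U a - U c| ≤ L * dist a c ^ κ := hlocal a haS c hcS (by linarith)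
      _ ≤ L * (2 * r) ^ κ := by gcongr
      _ < η := hr1
  have hext : ∀ x ∈ B, Filter.Tendsto U (nhdsWithin x S) (nhds (extendFrom S U x)) := fun x hx =>
    tendsto_extendFrom (hlim x hx)
  refine ⟨extendFrom S U, continuousOn_extendFrom hSB hlim, ?_, ?_⟩
  · rintro x ⟨hxS, hxB⟩
    refine extendFrom_eq (hSB hxB) ?_
    rw [tendsto_iff_dist_tendsto_zero]
    have hc : Continuous fun y => L * dist y x ^ κ :=
      continuous_const.mul ((continuous_id.dist continuous_const).rpow_const fun _ => Or.inr hκ.le)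
    have h0 : Filter.Tendsto (fun y => L * dist y x ^ κ) (nhdsWithin x S) (nhds 0) := by
      have := hc.tendsto x
      simp only [dist_self, Real.zero_rpow hκ.ne', mul_zero] at this
      exact this.mono_left nhdsWithin_le_nhds
    refine squeeze_zero' (Filter.Eventually.of_forall fun _ => dist_nonneg) ?_ h0
    filter_upwards [self_mem_nhdsWithin,
      mem_nhdsWithin_of_mem_nhds (Metric.ball_mem_nhds x one_pos)] with y hyS hy
    rw [Real.dist_eq]
    exact hlocal y hyS x hxS (le_of_lt hy)
  · intro x hx y hy
    rcases eq_or_ne x y with rfl | hne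
    · rw [sub_self, abs_zero]
      exact mul_nonneg hL (Real.rpow_nonneg dist_nonneg _)
    have : (nhdsWithin x S).NeBot := mem_closure_iff_nhdsWithin_neBot.1 (hSB hx)
    have : (nhdsWithin y S).NeBot := mem_closure_iff_nhdsWithin_neBot.1 (hSB hy)
    have hl : Filter.Tendsto (fun z : X × X => |U z.1 - U z.2|)
        (nhdsWithin x S ×ˢ nhdsWithin y S) (nhds |extendFrom S U x - extendFrom S U y|) :=
      (((hext x hx).comp Filter.tendsto_fst).sub ((hext y hy).comp Filter.tendsto_snd)).abs
    have hid : ∀ a : X, Filter.Tendsto (fun z => z) (nhdsWithin a S) (nhds a) := fun a =>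
      Filter.tendsto_id.mono_right nhdsWithin_le_nhds
    have hr : Filter.Tendsto (fun z : X × X => L * dist z.1 z.2 ^ α z.1)
        (nhdsWithin x S ×ˢ nhdsWithin y S) (nhds (L * dist x y ^ α x)) := by
      refine Filter.Tendsto.const_mul _ (Filter.Tendsto.rpow ?_ ?_ (Or.inl (dist_pos.2 hne).ne'))
      · exact ((hid x).comp Filter.tendsto_fst).dist ((hid y).comp Filter.tendsto_snd)
      · exact (hα.tendsto x).comp ((hid x).comp Filter.tendsto_fst)
    refine le_of_tendsto_of_tendsto hl hr ?_
    filter_upwards [Filter.prod_mem_prod (self_mem_nhdsWithin (a := x) (s := S))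
      (self_mem_nhdsWithin (a := y) (s := S))] with z hz
    exact hU z.1 hz.1 z.2 hz.2

/-- The majorant depends on `lam`, which must exceed the quasi-norm strictly. Taking `lam = n + 1 /
(k + 1)`, intersecting the countably many sets of full measure and letting `k → ∞` reaches the
quasi-norm, even when it is zero. -/
theorem exists_holder_ae (b δ σ Λ : ℝ) (hb : 0 < b) (hδ : 0 < δ) (hσ : 1 < σ) (hΛ : 1 ≤ Λ) :
    ∃ C : ℝ, 1 ≤ C ∧
      ∀ (X : Type w) [MetricSpace X] [MeasurableSpace X] [BorelSpace X] (μ : Measure X)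
        (Q p ε s : X → ℝ), Setting b δ Λ μ Q p ε s → (∀ x, (Λ ^ 2)⁻¹ ≤ holderExp Q p ε x) →
        ∀ (x₀ : X) (r₀ : ℝ) (q : X → ℝ≥0∞) (u : X → EReal) (g : ℤ → X → ℝ≥0∞),
          LocalData δ σ μ p s x₀ r₀ q u g →
          ∃ S : Set X, S ⊆ Metric.ball x₀ r₀ ∧ (∀ᵐ x ∂μ.restrict (Metric.ball x₀ r₀), x ∈ S) ∧
            (∀ x ∈ S, u x = ((u x).toReal : EReal)) ∧
            ∀ x ∈ S, ∀ y ∈ S, |(u x).toReal - (u y).toReal| ≤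
              C * (mixedNorm μ (Metric.ball x₀ (σ * r₀)) p q g).toReal *
                dist x y ^ holderExp Q p ε x := by
  have hΛ0 : 0 < Λ := by linarith
  obtain ⟨A, hA, hmaj⟩ := exists_gradient_majorant.{w} b δ σ Λ hb hδ hσ hΛ0
  obtain ⟨C, hC, hpt⟩ := exists_holder_pointwise.{w} Λ δ A σ hΛ hA hσ
  refine ⟨2 * C, by linarith, ?_⟩
  intro X _ _ _ μ Q p ε s hset hα x₀ r₀ q u g hloc
  have hexp := hset.regularExponents hΛ0 x₀
  have hfin := hloc.g_mem.mixedNorm_lt_top hΛ0 hexp.le_p hloc.q_mem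
  set n := (mixedNorm μ (Metric.ball x₀ (σ * r₀)) p q g).toReal with hn
  have hn0 : 0 ≤ n := ENNReal.toReal_nonneg
  have hlam : ∀ k : ℕ, mixedNorm μ (Metric.ball x₀ (σ * r₀)) p q g <
      ENNReal.ofReal (n + 1 / ((k : ℝ) + 1)) := fun k => by
    have : 0 < 1 / ((k : ℝ) + 1) := by positivity
    rw [← ENNReal.ofReal_toReal hfin.ne, ← hn]
    exact (ENNReal.ofReal_lt_ofReal_iff (by linarith)).2 (by linarith)
  have hBE : Metric.ball x₀ r₀ ⊆ Metric.ball x₀ (σ * r₀) :=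
    Metric.ball_subset_ball (by nlinarith [hloc.radius_pos])
  choose S H hdata hS hu _ using fun k : ℕ =>
    hmaj X μ Q p ε s hset x₀ r₀ q u g hloc _ (hlam k)
  refine ⟨{x | x ∈ Metric.ball x₀ r₀ ∧ ∀ k, x ∈ S k}, fun x hx => hx.1, ?_,
    fun x hx => hu 0 x (hx.2 0), fun x hx y hy => ?_⟩
  · have hS' := ae_all_iff.2 hS
    filter_upwards [ae_mono (Measure.restrict_mono hBE le_rfl) hS',
      ae_restrict_mem Metric.isOpen_ball.measurableSet] with x h1 h2 using ⟨h2, h1⟩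
  · have hk : ∀ k : ℕ, |(u x).toReal - (u y).toReal| ≤
        2 * (n + 1 / ((k : ℝ) + 1)) * (C * dist x y ^ holderExp Q p ε x) := fun k =>
      hpt X Q p ε x₀ r₀ (S k) _ (H k) _ hloc.radius_pos hloc.radius_le hα (hdata k)
        x ⟨hx.2 k, hx.1⟩ y ⟨hy.2 k, hy.1⟩
    have hlim : Filter.Tendsto (fun k : ℕ => 2 * (n + 1 / ((k : ℝ) + 1)) *
        (C * dist x y ^ holderExp Q p ε x)) Filter.atTop
        (nhds (2 * (n + 0) * (C * dist x y ^ holderExp Q p ε x))) :=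
      Filter.Tendsto.mul_const _ (Filter.Tendsto.const_mul _
        (tendsto_one_div_add_atTop_nhds_zero_nat.const_add n))
    have := ge_of_tendsto' hlim hk
    calc _ ≤ _ := this
      _ = _ := by ring

theorem morrey_inequality (b δ σ Λ : ℝ) (hb : 0 < b) (hδ : 0 < δ) (hσ : 1 < σ) (hΛ : 0 < Λ) :
    ∃ C_H : ℝ, 0 < C_H ∧
      ∀ (X : Type w) [MetricSpace X] [MeasurableSpace X] [BorelSpace X] (μ : Measure X)
        (Q p ε s : X → ℝ), Setting b δ Λ μ Q p ε s →
        EssGap μ Λ⁻¹ Q (fun x => ε x * p x) →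
        ∀ (x₀ : X) (r₀ : ℝ) (q : X → ℝ≥0∞) (u : X → EReal) (g : ℤ → X → ℝ≥0∞),
          LocalData δ σ μ p s x₀ r₀ q u g →
          IntegrableOn (fun x => (u x).toReal) (Metric.ball x₀ r₀) μ ∧
          essSup (absSub u (avg μ (Metric.ball x₀ r₀) u)) (μ.restrict (Metric.ball x₀ r₀)) ≤
            ENNReal.ofReal (C_H * r₀ ^ holderExp Q p ε x₀) *
              mixedNorm μ (Metric.ball x₀ (σ * r₀)) p q g ∧
          ∃ v : X → ℝ, ContinuousOn v (Metric.ball x₀ r₀) ∧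
            (∀ᵐ x ∂μ.restrict (Metric.ball x₀ r₀), u x = (v x : EReal)) ∧
            ∀ x ∈ Metric.ball x₀ r₀, ∀ y ∈ Metric.ball x₀ r₀,
              |v x - v y| ≤
                (2 : ℝ) ^ (essSup (holderExp Q p ε) μ + 1) * C_H *
                  (σ * δ / ((σ - 1) * r₀)) ^ essSup (holderExp Q p ε) μ *
                (mixedNorm μ (Metric.ball x₀ (σ * r₀)) p q g).toReal *
                dist x y ^ holderExp Q p ε x := by
  by_cases hΛ1 : 1 ≤ Λ
  swap
  · refine ⟨1, one_pos, fun X _ _ _ μ Q p ε s hset _ x₀ => ?_⟩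
    exact absurd (hset.regularExponents hΛ x₀).one_le hΛ1
  obtain ⟨C, hC, hae⟩ := exists_holder_ae.{w} b δ σ Λ hb hδ hσ hΛ1
  obtain ⟨K, hK, hcomp⟩ := exists_rpow_comparison.{w} Λ δ 1 hΛ1 le_rfl
  have h2Λ : (1 : ℝ) ≤ 2 ^ Λ := Real.one_le_rpow (by norm_num) hΛ.le
  have hC0 : 0 < C := by linarith
  -- From `dist x y ≤ 2 * r₀` and `holderExp ≤ Λ` comes `2 ^ Λ`; `K` moves the exponent of `r₀` from
  -- `x` to `x₀`.
  refine ⟨C * (2 ^ Λ * K), by positivity, ?_⟩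
  intro X _ _ _ μ Q p ε s hset hgap x₀ r₀ q u g hloc
  have hexp := hset.regularExponents hΛ x₀
  have hfin := hloc.g_mem.mixedNorm_lt_top hΛ hexp.le_p hloc.q_mem
  set n := (mixedNorm μ (Metric.ball x₀ (σ * r₀)) p q g).toReal with hn
  have hn0 : 0 ≤ n := ENNReal.toReal_nonneg
  have hnn : mixedNorm μ (Metric.ball x₀ (σ * r₀)) p q g = ENNReal.ofReal n :=
    (ENNReal.ofReal_toReal hfin.ne).symm
  have hgap' : ∀ x, Λ⁻¹ ≤ ε x * p x - Q x :=
    forall_le_of_ae_le hset.metricMeasure continuous_const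
      ((hexp.continuous_ε.mul hexp.continuous_p).sub hexp.continuous_Q) hgap
  have hα : ∀ x, (Λ ^ 2)⁻¹ ≤ holderExp Q p ε x := fun x => by
    have hp := hexp.p_pos x
    have e : holderExp Q p ε x = (ε x * p x - Q x) / p x := by rw [holderExp]; field_simp
    rw [e, pow_two, mul_inv, ← div_eq_mul_inv]
    exact div_le_div₀ ((inv_pos.2 hΛ).le.trans (hgap' x)) (hgap' x) hp (hexp.p_le x)
  have hκ : 0 < (Λ ^ 2)⁻¹ := by positivity
  have hα0 : ∀ x, 0 ≤ holderExp Q p ε x := fun x => hκ.le.trans (hα x)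
  have hr₀ := hloc.radius_pos
  have hr₀δ : r₀ ≤ δ := hloc.radius_le.trans (div_le_self hδ.le hσ.le)
  obtain ⟨S, hSB, hS, hu, hSU⟩ := hae X μ Q p ε s hset hα x₀ r₀ q u g hloc
  set B := Metric.ball x₀ r₀ with hB
  have hBm : MeasurableSet B := Metric.isOpen_ball.measurableSet
  have hBE : B ⊆ Metric.ball x₀ (σ * r₀) := Metric.ball_subset_ball (by nlinarith)
  have hBμ : 0 < μ B ∧ μ B < ∞ := hset.metricMeasure x₀ r₀ hr₀
  -- A set of full measure meets every ball, as balls have positive measure.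
  have hdense : B ⊆ closure S := by
    intro x hx
    rw [Metric.mem_closure_iff]
    intro r hr
    obtain ⟨r', hr', hsub⟩ := Metric.isOpen_iff.1 (Metric.isOpen_ball (x := x₀) (ε := r₀)) x hx
    have hpos := (hset.metricMeasure x (min r r') (lt_min hr hr')).1
    have hball : Metric.ball x (min r r') ⊆ B :=
      (Metric.ball_subset_ball (min_le_right _ _)).trans hsub
    rw [ae_restrict_iff' hBm] at hS
    obtain ⟨y, hy, hyS⟩ : ∃ y ∈ Metric.ball x (min r r'), y ∈ B → y ∈ S := by
      by_contra hcon
      push Not at hcon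
      exact hpos.ne' (measure_mono_null (fun y hy => by simpa using hcon y hy) (ae_iff.1 hS))
    refine ⟨y, hyS (hball hy), ?_⟩
    rw [dist_comm]
    exact lt_of_lt_of_le hy (min_le_left _ _)
  set T : ℝ := C * (2 ^ Λ * K) * r₀ ^ holderExp Q p ε x₀ * n with hT
  have hT0 : 0 ≤ T := by positivity
  have hosc : ∀ x ∈ S, ∀ y ∈ S, |(u x).toReal - (u y).toReal| ≤ T := by
    intro x hx y hy
    have hxd : dist x x₀ < r₀ := hSB hx
    have hyd : dist y x₀ < r₀ := hSB hy
    have hd : dist x y ≤ 2 * r₀ := by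
      have := dist_triangle_right x y x₀
      linarith
    have h1 := (hcomp X Q p ε hexp x x₀ r₀ hr₀ hr₀δ (by linarith)).2.2.2.2.2
    have h2 : holderExp Q p ε x ≤ Λ := by
      have := hexp.Q_div_p_nonneg x
      have := hexp.ε_le x
      rw [holderExp]; linarith
    have h3 : dist x y ^ holderExp Q p ε x ≤ 2 ^ Λ * (K * r₀ ^ holderExp Q p ε x₀) := by
      calc dist x y ^ holderExp Q p ε x ≤ (2 * r₀) ^ holderExp Q p ε x :=
            Real.rpow_le_rpow dist_nonneg hd (hα0 x)
        _ = 2 ^ holderExp Q p ε x * r₀ ^ holderExp Q p ε x :=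
            Real.mul_rpow (by norm_num) hr₀.le
        _ ≤ _ := by
            gcongr
            norm_num
    calc _ ≤ C * n * dist x y ^ holderExp Q p ε x := hSU x hx y hy
      _ ≤ C * n * (2 ^ Λ * (K * r₀ ^ holderExp Q p ε x₀)) := by gcongr
      _ = T := by rw [hT]; ring
  have hU : AEMeasurable (fun x => (u x).toReal) (μ.restrict B) :=
    ((aemeasurable_restrict_of_measurable_subtype Metric.isOpen_ball.measurableSet
      hloc.u_mem.measurable).mono_measure (Measure.restrict_mono hBE le_rfl)).ereal_toReal
  obtain ⟨z, hzS⟩ : S.Nonempty := closure_nonempty_iff.1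
    ⟨x₀, hdense (Metric.mem_ball_self hr₀)⟩
  have hint : IntegrableOn (fun x => (u x).toReal) B μ := by
    refine IntegrableOn.of_bound hBμ.2 hU.aestronglyMeasurable (|(u z).toReal| + T) ?_
    filter_upwards [hS] with x hx
    have h1 := hosc x hx z hzS
    have h2 := abs_sub_abs_le_abs_sub (u x).toReal (u z).toReal
    rw [Real.norm_eq_abs]
    linarith
  refine ⟨hint, ?_, ?_⟩
  · have e : ENNReal.ofReal (C * (2 ^ Λ * K) * r₀ ^ holderExp Q p ε x₀) *
        mixedNorm μ (Metric.ball x₀ (σ * r₀)) p q g = ENNReal.ofReal T := by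
      rw [hnn, ← ENNReal.ofReal_mul (by positivity)]
    rw [e]
    refine essSup_le_of_ae_le _ ?_
    filter_upwards [hS] with x hx
    rw [absSub_eq (hu x hx)]
    refine ENNReal.ofReal_le_ofReal ?_
    -- The closed ball of radius `T` about the value at `x` is convex and contains almost all
    -- values, hence also their average.
    have hmem : avg μ B u ∈ Metric.closedBall (u x).toReal T := by
      refine (convex_closedBall _ _).set_average_mem Metric.isClosed_closedBall hBμ.1.ne'
        hBμ.2.ne ?_ hint
      filter_upwards [hS] with y hy
      rw [Metric.mem_closedBall, Real.dist_eq]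
      exact hosc y hy x hx
    rwa [Metric.mem_closedBall, dist_comm, Real.dist_eq] at hmem
  · obtain ⟨v, hv, hvu, hvh⟩ := exists_holder_extension hdense hexp.continuous_holderExp hκ hα
      (mul_nonneg hC0.le hn0) hSU
    refine ⟨v, hv, ?_, fun x hx y hy => (hvh x hx y hy).trans ?_⟩
    · filter_upwards [hS] with x hx
      rw [hu x hx, hvu x ⟨hx, hSB hx⟩]
    set a := essSup (holderExp Q p ε) μ with ha
    have ha0 : 0 ≤ a := by
      have hle : ∀ᵐ x ∂μ, holderExp Q p ε x ≤ a := ae_le_essSup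
        ⟨Λ ^ 2, Filter.eventually_map.2 (Filter.Eventually.of_forall fun x =>
          (le_abs_self _).trans (hexp.abs_holderExp_le x))⟩
      have hne : μ ≠ 0 := fun h0 => by rw [h0] at hBμ; simp at hBμ
      have : (ae μ).NeBot := ae_neBot.2 hne
      obtain ⟨x, hx⟩ := hle.exists
      exact (hα0 x).trans hx
    have h1 : (1 : ℝ) ≤ 2 ^ (a + 1) := Real.one_le_rpow (by norm_num) (by linarith)
    have h2 : 1 ≤ (σ * δ / ((σ - 1) * r₀)) ^ a := by
      refine Real.one_le_rpow ?_ ha0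
      have hσ1 : 0 < σ - 1 := by linarith
      rw [one_le_div (by positivity)]
      nlinarith
    -- The extension already satisfies the Hölder bound with the constant `C`; the remaining factors
    -- of `D_H` are all at least `1`.
    have h3 : C ≤ 2 ^ (a + 1) * (C * (2 ^ Λ * K)) * (σ * δ / ((σ - 1) * r₀)) ^ a := by
      have h4 : C ≤ C * (2 ^ Λ * K) :=
        le_mul_of_one_le_right hC0.le (one_le_mul_of_one_le_of_one_le h2Λ hK)
      have h5 : 0 ≤ C * (2 ^ Λ * K) := by positivity
      calc C ≤ C * (2 ^ Λ * K) := h4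
        _ ≤ 2 ^ (a + 1) * (C * (2 ^ Λ * K)) := le_mul_of_one_le_left h5 h1
        _ ≤ _ := le_mul_of_one_le_right (by positivity) h2
    have h6 : 0 ≤ dist x y ^ holderExp Q p ε x := Real.rpow_nonneg dist_nonneg _
    gcongr

end HajlaszBesov

/-! ### The three cases together -/

open HajlaszBesov in
theorem mainTheorem5 (b δ σ Λ : ℝ) (hb : 0 < b) (hb1 : b ≤ 1) (hδ : 0 < δ) (hσ : 1 < σ)
    (hΛ : 0 < Λ) :
    -- (i) the Sobolev case
    (∃ C_S : ℝ, 0 < C_S ∧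
      ∀ (X : Type w) [MetricSpace X] [MeasurableSpace X] [BorelSpace X] (μ : Measure X)
        (Q p ε s : X → ℝ), Setting b δ Λ μ Q p ε s →
        EssGap μ Λ⁻¹ (fun x => ε x * p x) Q →
        ∀ (x₀ : X) (r₀ : ℝ) (q : X → ℝ≥0∞) (u : X → EReal) (g : ℤ → X → ℝ≥0∞),
          LocalData δ σ μ p s x₀ r₀ q u g →
          ⨅ c : ℝ, luxNorm μ (Metric.ball x₀ r₀) (sobolevExp Q p ε) (absSub u c) ≤
            ENNReal.ofReal (C_S * (μ.real (Metric.ball x₀ r₀) / r₀ ^ Q x₀) ^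
              (1 / essInf (sobolevExp Q p ε) (μ.restrict (Metric.ball x₀ r₀)))) *
            mixedNorm μ (Metric.ball x₀ (σ * r₀)) p q g) ∧
    -- (ii) the Moser-Trudinger case
    (∃ C_MT1 C_MT2 : ℝ, 0 < C_MT1 ∧ 0 < C_MT2 ∧
      ∀ (X : Type w) [MetricSpace X] [MeasurableSpace X] [BorelSpace X] (μ : Measure X)
        (Q p ε s : X → ℝ), Setting b δ Λ μ Q p ε s →
        (∀ x, ε x * p x = Q x) →
        ∀ (x₀ : X) (r₀ : ℝ) (q : X → ℝ≥0∞) (u : X → EReal) (g : ℤ → X → ℝ≥0∞),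
          LocalData δ σ μ p s x₀ r₀ q u g →
          0 < mixedNorm μ (Metric.ball x₀ (σ * r₀)) p q g →
          IntegrableOn (fun x => (u x).toReal) (Metric.ball x₀ r₀) μ ∧
          ⨍⁻ x in Metric.ball x₀ r₀, ENNReal.ofReal (Real.exp
            (C_MT1 * (|(u x).toReal - avg μ (Metric.ball x₀ r₀) u| /
              (mixedNorm μ (Metric.ball x₀ (σ * r₀)) p q g).toReal))) ∂μ ≤
            ENNReal.ofReal C_MT2) ∧
    -- (iii) the Morrey case
    (∃ C_H : ℝ, 0 < C_H ∧
      ∀ (X : Type w) [MetricSpace X] [MeasurableSpace X] [BorelSpace X] (μ : Measure X)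
        (Q p ε s : X → ℝ), Setting b δ Λ μ Q p ε s →
        EssGap μ Λ⁻¹ Q (fun x => ε x * p x) →
        ∀ (x₀ : X) (r₀ : ℝ) (q : X → ℝ≥0∞) (u : X → EReal) (g : ℤ → X → ℝ≥0∞),
          LocalData δ σ μ p s x₀ r₀ q u g →
          IntegrableOn (fun x => (u x).toReal) (Metric.ball x₀ r₀) μ ∧
          essSup (absSub u (avg μ (Metric.ball x₀ r₀) u)) (μ.restrict (Metric.ball x₀ r₀)) ≤
            ENNReal.ofReal (C_H * r₀ ^ holderExp Q p ε x₀) *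
              mixedNorm μ (Metric.ball x₀ (σ * r₀)) p q g ∧
          ∃ v : X → ℝ, ContinuousOn v (Metric.ball x₀ r₀) ∧
            (∀ᵐ x ∂μ.restrict (Metric.ball x₀ r₀), u x = (v x : EReal)) ∧
            ∀ x ∈ Metric.ball x₀ r₀, ∀ y ∈ Metric.ball x₀ r₀,
              |v x - v y| ≤
                (2 : ℝ) ^ (essSup (holderExp Q p ε) μ + 1) * C_H *
                  (σ * δ / ((σ - 1) * r₀)) ^ essSup (holderExp Q p ε) μ *
                (mixedNorm μ (Metric.ball x₀ (σ * r₀)) p q g).toReal *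
                dist x y ^ holderExp Q p ε x) :=
  ⟨sobolev_inequality b δ σ Λ hb hδ hσ hΛ, moser_trudinger_inequality b δ σ Λ hb hδ hσ hΛ,
    morrey_inequality b δ σ Λ hb hδ hσ hΛ⟩
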